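/- Let $d,n$ be natural numbers with $n\ge d+1$ and let $\alpha\in(0,1]$. For $X=(x_1,\dots,x_n)\in\mathbb R^{d\times n}$ put $\mathrm{cent}(X)=X-\frac1nX1_n1_n^T$, where $1_n\in\mathbb R^n$ is the all-ones vector, and let $$\Omega'_{d,n}=\{X\in\mathbb R^{d\times n}:\ \text{the } d \text{ singular values of } \mathrm{cent}(X) \text{ are pairwise distinct and } \|\mathrm{cent}(X)\|_F\le 1\}.$$ For $X\in\Omega'_{d,n}$ let $D$ be the $d\times d$ diagonal matrix of the singular values of $\mathrm{cent}(X)$ in nonincreasing order. There are exactly $2^d$ matrices $U_1,\dots,U_{2^d}\in O(d)$ for which $\mathrm{cent}(X)=U_jDV_j^T$ for some $V_j\in\mathbb R^{n\times d}$ with orthonormal columns. For $g:\mathbb R^{d\times n}\to\mathbb R$ define $$\mathcal I[g](X)=2^{-d}\sum_{j=1}^{2^d} g\big(U_j^{-1}\mathrm{cent}(X)\big).$$ A Deep Sets model is a function $\psi(X)=\rho\big(\sum_{i=1}^n\Phi(x_i)\big)$, where $\Phi:\mathbb R^d\to\mathbb R^N$ and $\rho:\mathbb R^N\to\mathbb R$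 (for some $N$) are feedforward ReLU networks; its number of parameters is the total number of entries of the weight matrices and bias vectors of $\Phi$ and $\rho$. Then there is a constant $C=C(d,n,\alpha)$ such that for every $\epsilon\in(0,1]$ and every function $f:\mathbb R^{d\times n}\to\mathbb R$ that is invariant under $E(d)\times S_n$ (that is, $f(Rx_{\sigma(1)}+t,\dots,Rx_{\sigma(n)}+t)=f(x_1,\dots,x_n)$ for all $R\in O(d)$, $t\in\mathbb R^d$ and permutations $\sigma$) and $\alpha$-Hölder with seminorm $|f|_\alpha=\sup_{X\ne Y}|f(X)-f(Y)|/\|X-Y\|_F^\alpha=1$, there is a Deep Sets model $\psi$ with at most $$C\,\epsilon^{-\frac{nd-\dim E(d)}{2\alpha}}\,(1+|\log\epsilon|)$$ parameters, where $\dim E(d)=\frac{d(d+1)}2$, such that $$|f(X)-\mathcal I[\psi](X)|\le\epsilon\qquad\text{for all }X\in\Omega'_{d,n}.$$ -/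

import Mathlib

open Matrix
open scoped NNReal ENNReal

-- Distances between matrices, hence Hölder seminorms, refer to the Frobenius norm.
attribute [local instance] Matrix.frobeniusSeminormedAddCommGroup
  Matrix.frobeniusNormedAddCommGroup

/-- Feedforward ReLU networks `ℝ^m → ℝ^k`: finitely many affine layers of arbitrary widths, the
activation being applied after each of them except the last. -/
inductive ReLUNetwork : ℕ → ℕ → Type
  | output {m k : ℕ} (W : Matrix (Fin k) (Fin m) ℝ) (b : Fin k → ℝ) : ReLUNetwork m k
  | hidden {m l k : ℕ} (W : Matrix (Fin l) (Fin m) ℝ) (b : Fin l → ℝ)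
      (next : ReLUNetwork l k) : ReLUNetwork m k

namespace ReLUNetwork

/-- The function computed by a ReLU network. -/
noncomputable def eval : {m k : ℕ} → ReLUNetwork m k → (Fin m → ℝ) → (Fin k → ℝ)
  | _, _, output W b, x => W *ᵥ x + b
  | _, _, hidden W b next, x => next.eval fun i => max ((W *ᵥ x + b) i) 0

/-- The number of parameters: all entries of all weight matrices and of all bias vectors. -/
def numParams : {m k : ℕ} → ReLUNetwork m k → ℕ
  | m, k, output _ _ => k * m + k
  | m, _, hidden (l := l) _ _ next => l * m + l + next.numParams

end ReLUNetwork

/-- A Deep Sets model `X = (x₁, …, xₙ) ↦ ρ (∑ⱼ Φ xⱼ)` on point clouds in `ℝ^d`. -/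
structure DeepSets (d : ℕ) where
  /-- the latent dimension -/
  latentDim : ℕ
  /-- the inner network, applied to each point -/
  inner : ReLUNetwork d latentDim
  /-- the outer network, applied to the sum -/
  outer : ReLUNetwork latentDim 1

namespace DeepSets

/-- The value of a Deep Sets model on the point cloud whose points are the columns of `X`. -/
noncomputable def eval {d n : ℕ} (ψ : DeepSets d) (X : Matrix (Fin d) (Fin n) ℝ) : ℝ :=
  ψ.outer.eval (∑ j, ψ.inner.eval fun i => X i j) 0

/-- The total number of parameters of both networks. -/
def numParams {d : ℕ} (ψ : DeepSets d) : ℕ :=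
  ψ.inner.numParams + ψ.outer.numParams

end DeepSets

/-- Invariance under `E(d) × Sₙ`: simultaneous orthogonal transformation and translation of all
points (columns), and reordering of the points. -/
def IsRigidPermInvariant {d n : ℕ} (f : Matrix (Fin d) (Fin n) ℝ → ℝ) : Prop :=
  ∀ R ∈ Matrix.orthogonalGroup (Fin d) ℝ, ∀ (t : Fin d → ℝ) (σ : Equiv.Perm (Fin n))
    (X : Matrix (Fin d) (Fin n) ℝ), f (Matrix.of fun i j => (R * X) i (σ j) + t i) = f X

/-- The centralization `X - (1/n) X 1ₙ 1ₙᵀ`. -/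
noncomputable def cent {d n : ℕ} (X : Matrix (Fin d) (Fin n) ℝ) : Matrix (Fin d) (Fin n) ℝ :=
  X - (n : ℝ)⁻¹ • (X * Matrix.of fun _ _ => (1 : ℝ))

/-- The first `d` singular values of a `d × n` matrix, in nonincreasing order
(these are all its singular values when `d ≤ n`). -/
noncomputable def matrixSingularValues {d n : ℕ} (A : Matrix (Fin d) (Fin n) ℝ) (i : Fin d) : ℝ :=
  (Matrix.toEuclideanLin A).singularValues i

/-- The point clouds `X` such that the singular values of `cent X` are pairwise distinct and
`‖cent X‖_F ≤ 1`. -/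
def distinctSingularValueClouds (d n : ℕ) : Set (Matrix (Fin d) (Fin n) ℝ) :=
  {X | Function.Injective (matrixSingularValues (cent X)) ∧ ‖cent X‖ ≤ 1}

/-- The orthogonal factors `U` of the singular value decompositions `A = U D Vᵀ`, where
`U ∈ O(d)`, `D` is the `d × d` diagonal matrix of the singular values of `A` and `V` is an
`n × d` matrix with orthonormal columns. -/
def svdFactors {d n : ℕ} (A : Matrix (Fin d) (Fin n) ℝ) : Set (Matrix (Fin d) (Fin d) ℝ) :=
  {U | U ∈ Matrix.orthogonalGroup (Fin d) ℝ ∧ ∃ V : Matrix (Fin n) (Fin d) ℝ,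
    Vᵀ * V = 1 ∧ A = U * Matrix.diagonal (matrixSingularValues A) * Vᵀ}

/-- Every `d × n` matrix with `d ≤ n` has a singular value decomposition of this form. -/
theorem exists_mem_svdFactors {d n : ℕ} (hdn : d ≤ n) (A : Matrix (Fin d) (Fin n) ℝ) :
    (svdFactors A).Nonempty := by
  classical
  set T := Matrix.toEuclideanLin A with hTdef
  have hfin : Module.finrank ℝ (EuclideanSpace ℝ (Fin n)) = n := finrank_euclideanSpace_fin
  set v := T.isSymmetric_adjoint_comp_self.eigenvectorBasis hfin with hv
  have hev : ∀ j, T.adjoint (T (v j)) = (T.singularValues j ^ 2 : ℝ) • v j := by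
    intro j
    have h := T.isSymmetric_adjoint_comp_self.apply_eigenvectorBasis hfin j
    rw [T.sq_singularValues_fin hfin j]
    exact h
  have hin : ∀ i j, inner ℝ (T (v i)) (T (v j)) = if i = j then T.singularValues j ^ 2 else 0 := by
    intro i j
    rw [← LinearMap.adjoint_inner_right, hev, inner_smul_right,
      orthonormal_iff_ite.1 v.orthonormal]
    split_ifs <;> simp
  have hzero : ∀ j, T.singularValues (j : Fin n) = 0 → T (v j) = 0 := by
    intro j hj
    have := hin j j
    rw [if_pos rfl, hj] at this
    simpa using this
  let w : Fin d → EuclideanSpace ℝ (Fin d) := fun i =>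
    (T.singularValues i)⁻¹ • T (v (Fin.castLE hdn i))
  let s : Set (Fin d) := {i | T.singularValues i ≠ 0}
  have hw : Orthonormal ℝ (s.domRestrict w) := by
    rw [orthonormal_iff_ite]
    rintro ⟨i, hi⟩ ⟨j, hj⟩
    simp only [Set.domRestrict_apply, w, inner_smul_left, inner_smul_right, hin, Subtype.mk.injEq]
    by_cases h : i = j
    · subst h
      have : T.singularValues i ≠ 0 := hi
      simp
      field_simp
    · have : Fin.castLE hdn i ≠ Fin.castLE hdn j := by
        simpa [Fin.ext_iff] using h
      simp [h]
  obtain ⟨u, hu⟩ := hw.exists_orthonormalBasis_extension_of_card_eq (by simp)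
  have hTv : ∀ i : Fin d, T (v (Fin.castLE hdn i)) = T.singularValues i • u i := by
    intro i
    by_cases hi : T.singularValues i = 0
    · rw [hzero _ (by simpa using hi), hi, zero_smul]
    · rw [hu i hi, smul_smul, mul_inv_cancel₀ hi, one_smul]
  have hbig : ∀ j : Fin n, d ≤ j → T (v j) = 0 := by
    intro j hj
    apply hzero
    rw [LinearMap.singularValues_eq_zero_iff_le_finrank_range]
    refine le_trans (Submodule.finrank_le _) ?_
    simpa using hj
  refine ⟨Matrix.of fun i k => u k i, ?_, Matrix.of fun j k => v (Fin.castLE hdn k) j, ?_, ?_⟩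
  · rw [Matrix.mem_orthogonalGroup_iff']
    ext i j
    have := orthonormal_iff_ite.1 u.orthonormal i j
    rw [PiLp.inner_apply] at this
    simp [Matrix.mul_apply, Matrix.one_apply] at this ⊢
    rw [← this]
    exact Finset.sum_congr rfl fun _ _ => mul_comm _ _
  · ext i j
    have := orthonormal_iff_ite.1 v.orthonormal (Fin.castLE hdn i) (Fin.castLE hdn j)
    rw [PiLp.inner_apply] at this
    simp [Matrix.mul_apply, Matrix.one_apply, Fin.ext_iff] at this ⊢
    rw [← this]
    exact Finset.sum_congr rfl fun _ _ => mul_comm _ _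
  · have key : ∀ x, T x = ∑ k : Fin d, (inner ℝ (v (Fin.castLE hdn k)) x * T.singularValues k) • u k := by
      intro x
      conv_lhs => rw [← v.sum_repr' x, map_sum]
      simp only [map_smul]
      symm
      calc _ = ∑ k : Fin d, inner ℝ (v (Fin.castLE hdn k)) x • T (v (Fin.castLE hdn k)) := by
            simp [hTv, smul_smul]
        _ = ∑ j ∈ Finset.univ.map (Fin.castLEEmb hdn), inner ℝ (v j) x • T (v j) := by
            rw [Finset.sum_map]; rfl
        _ = _ := by
            refine Finset.sum_subset (Finset.subset_univ _) fun j _ hj => ?_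
            rw [hbig j, smul_zero]
            by_contra! hlt
            exact hj (Finset.mem_map.2 ⟨⟨j, hlt⟩, Finset.mem_univ _, rfl⟩)
    ext i j
    have h1 := congrArg (fun y : EuclideanSpace ℝ (Fin d) => y i) (key (EuclideanSpace.single j 1))
    simp [hTdef, Matrix.toLpLin_apply, EuclideanSpace.inner_single_right] at h1
    rw [h1, Matrix.mul_apply]
    refine Finset.sum_congr rfl fun k _ => ?_
    simp [matrixSingularValues, ← hTdef, Matrix.mul_diagonal]
    ring

/-- If the singular values are pairwise distinct, there are exactly `2^d` orthogonal factors. -/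
theorem ncard_svdFactors {d n : ℕ} (hdn : d ≤ n) (A : Matrix (Fin d) (Fin n) ℝ)
    (hA : Function.Injective (matrixSingularValues A)) : (svdFactors A).ncard = 2 ^ d := by
  classical
  obtain ⟨U₀, hU₀, V₀, hV₀, hA₀⟩ := exists_mem_svdFactors hdn A
  set σ := matrixSingularValues A with hσ
  have hσ0 : ∀ i, 0 ≤ σ i := fun i => LinearMap.singularValues_nonneg _ _
  have hgram : ∀ (U : Matrix (Fin d) (Fin d) ℝ) (V : Matrix (Fin n) (Fin d) ℝ), Vᵀ * V = 1 →
      A = U * Matrix.diagonal σ * Vᵀ → A * Aᵀ = U * Matrix.diagonal (fun i => σ i ^ 2) * Uᵀ := by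
    intro U V hV h
    have : Matrix.diagonal (fun i => σ i ^ 2) = Matrix.diagonal σ * Matrix.diagonal σ := by
      simp [sq]
    rw [this]
    conv_lhs => rw [h]
    simp only [Matrix.transpose_mul, Matrix.transpose_transpose, Matrix.diagonal_transpose]
    calc _ = U * Matrix.diagonal σ * (Vᵀ * V) * (Matrix.diagonal σ * Uᵀ) := by
          simp only [Matrix.mul_assoc]
      _ = _ := by rw [hV]; simp only [Matrix.mul_assoc, Matrix.mul_one]
  have hU₀' : U₀ᵀ * U₀ = 1 := (Matrix.mem_orthogonalGroup_iff' (Fin d) ℝ).1 hU₀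
  have hU₀'' : U₀ * U₀ᵀ = 1 := (Matrix.mem_orthogonalGroup_iff (Fin d) ℝ).1 hU₀
  let F : (Fin d → ℤˣ) → Matrix (Fin d) (Fin d) ℝ := fun s =>
    U₀ * Matrix.diagonal fun i => ((s i : ℤ) : ℝ)
  have hs2 : ∀ s : Fin d → ℤˣ, (Matrix.diagonal fun i => ((s i : ℤ) : ℝ)) *
      (Matrix.diagonal fun i => ((s i : ℤ) : ℝ)) = 1 := by
    intro s
    rw [Matrix.diagonal_mul_diagonal, ← Matrix.diagonal_one]
    congr 1
    ext i
    rcases Int.units_eq_one_or (s i) with h | h <;> simp [h]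
  have hF : Function.Injective F := by
    intro s t h
    have h2 := congrArg (fun M => U₀ᵀ * M) h
    simp only [F, ← Matrix.mul_assoc, hU₀', Matrix.one_mul] at h2
    have h3 := Matrix.diagonal_injective h2
    ext i
    exact_mod_cast congrFun h3 i
  have hrange : svdFactors A = Set.range F := by
    ext U
    constructor
    · rintro ⟨hU, V, hV, hUV⟩
      have hU' : Uᵀ * U = 1 := (Matrix.mem_orthogonalGroup_iff' (Fin d) ℝ).1 hU
      have hU'' : U * Uᵀ = 1 := (Matrix.mem_orthogonalGroup_iff (Fin d) ℝ).1 hU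
      have e := (hgram U V hV hUV).symm.trans (hgram U₀ V₀ hV₀ hA₀)
      have hcomm : (U₀ᵀ * U) * Matrix.diagonal (fun i => σ i ^ 2) =
          Matrix.diagonal (fun i => σ i ^ 2) * (U₀ᵀ * U) := by
        calc _ = U₀ᵀ * (U * Matrix.diagonal (fun i => σ i ^ 2) * Uᵀ) * U := by
              simp only [Matrix.mul_assoc, hU', Matrix.mul_one]
          _ = (U₀ᵀ * U₀) * Matrix.diagonal (fun i => σ i ^ 2) * (U₀ᵀ * U) := by
              rw [e]; simp only [Matrix.mul_assoc]
          _ = _ := by rw [hU₀', Matrix.one_mul]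
      set S := U₀ᵀ * U with hS
      have hoff : ∀ i j, i ≠ j → S i j = 0 := by
        intro i j hij
        have := congrFun (congrFun hcomm i) j
        rw [Matrix.mul_diagonal, Matrix.diagonal_mul] at this
        have hne : σ i ^ 2 ≠ σ j ^ 2 := fun h =>
          hij (hA ((sq_eq_sq₀ (hσ0 i) (hσ0 j)).1 h))
        by_contra hc
        exact hne (mul_right_cancel₀ hc (by linarith))
      have hSd : S = Matrix.diagonal fun i => S i i := by
        ext i j
        by_cases h : i = j
        · subst h; simp
        · simp [h, hoff i j h]
      have hSS : Sᵀ * S = 1 := by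
        rw [hS, Matrix.transpose_mul, Matrix.transpose_transpose]
        calc _ = Uᵀ * (U₀ * U₀ᵀ) * U := by simp only [Matrix.mul_assoc]
          _ = 1 := by rw [hU₀'', Matrix.mul_one, hU']
      have hpm : ∀ i, S i i = 1 ∨ S i i = -1 := by
        intro i
        rw [hSd, Matrix.diagonal_transpose, Matrix.diagonal_mul_diagonal] at hSS
        have := congrFun (congrFun hSS i) i
        simp only [Matrix.diagonal_apply_eq, Matrix.one_apply_eq] at this
        exact mul_self_eq_one_iff.1 this
      refine ⟨fun i => if S i i = 1 then 1 else -1, ?_⟩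
      have : (Matrix.diagonal fun i => (((if S i i = 1 then 1 else -1 : ℤˣ) : ℤ) : ℝ)) = S := by
        conv_rhs => rw [hSd]
        congr 1
        ext i
        rcases hpm i with h | h
        · simp [h]
        · rw [h]; norm_num
      change U₀ * (Matrix.diagonal fun i => (((if S i i = 1 then 1 else -1 : ℤˣ) : ℤ) : ℝ)) = U
      rw [this, hS, ← Matrix.mul_assoc, hU₀'', Matrix.one_mul]
    · rintro ⟨s, rfl⟩
      refine ⟨?_, V₀ * Matrix.diagonal (fun i => ((s i : ℤ) : ℝ)), ?_, ?_⟩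
      · rw [Matrix.mem_orthogonalGroup_iff]
        simp only [F, Matrix.transpose_mul, Matrix.diagonal_transpose]
        calc _ = U₀ * ((Matrix.diagonal fun i => ((s i : ℤ) : ℝ)) *
              (Matrix.diagonal fun i => ((s i : ℤ) : ℝ))) * U₀ᵀ := by simp only [Matrix.mul_assoc]
          _ = 1 := by rw [hs2, Matrix.mul_one, hU₀'']
      · simp only [Matrix.transpose_mul, Matrix.diagonal_transpose]
        calc _ = (Matrix.diagonal fun i => ((s i : ℤ) : ℝ)) * (V₀ᵀ * V₀) *
              (Matrix.diagonal fun i => ((s i : ℤ) : ℝ)) := by simp only [Matrix.mul_assoc]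
          _ = 1 := by rw [hV₀, Matrix.mul_one, hs2]
      · rw [← hσ]
        simp only [F, Matrix.transpose_mul, Matrix.diagonal_transpose]
        have hc : (Matrix.diagonal fun i => ((s i : ℤ) : ℝ)) * Matrix.diagonal σ =
            Matrix.diagonal σ * (Matrix.diagonal fun i => ((s i : ℤ) : ℝ)) := by
          simp [Matrix.diagonal_mul_diagonal, mul_comm]
        calc A = U₀ * Matrix.diagonal σ * V₀ᵀ := hA₀
          _ = U₀ * (Matrix.diagonal σ * ((Matrix.diagonal fun i => ((s i : ℤ) : ℝ)) *
              (Matrix.diagonal fun i => ((s i : ℤ) : ℝ)))) * V₀ᵀ := by rw [hs2, Matrix.mul_one]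
          _ = _ := by
              rw [← Matrix.mul_assoc (Matrix.diagonal σ), ← hc]; simp only [Matrix.mul_assoc]
  rw [hrange, Set.ncard_range_of_injective hF, Nat.card_eq_fintype_card]
  simp

/-- The averaging operator of the SVD frame, `f ↦ 2^{-d} ∑_U f (U⁻¹ cent X)`, the sum running over
the `2^d` orthogonal factors `U` of the singular value decompositions of `cent X`. -/
noncomputable def svdFrameAverage {d n : ℕ} (f : Matrix (Fin d) (Fin n) ℝ → ℝ)
    (X : Matrix (Fin d) (Fin n) ℝ) : ℝ :=
  ((2 : ℝ) ^ d)⁻¹ * ∑ᶠ U ∈ svdFactors (cent X), f (U⁻¹ * cent X)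

/-- The dimension of the Lie group `E(d) = O(d) ⋉ ℝ^d`: the dimension of the Lie algebra of `O(d)`
(the skew-symmetric matrices) plus `d`. -/
noncomputable def dimEuclideanGroup (d : ℕ) : ℕ :=
  Module.finrank ℝ (LieAlgebra.Orthogonal.so (Fin d) ℝ) + d

theorem dimEuclideanGroup_eq (d : ℕ) : dimEuclideanGroup d = d * (d + 1) / 2 := by
  classical
  let e : LieAlgebra.Orthogonal.so (Fin d) ℝ ≃ₗ[ℝ] ({p : Fin d × Fin d // p.1 < p.2} → ℝ) :=
    { toFun := fun A p => A.1 p.1.1 p.1.2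
      map_add' := fun _ _ => rfl
      map_smul' := fun _ _ => rfl
      invFun := fun g => ⟨Matrix.of fun i j =>
        if h : i < j then g ⟨(i, j), h⟩ else if h : j < i then -g ⟨(j, i), h⟩ else 0, by
          rw [LieAlgebra.Orthogonal.mem_so]
          ext i j
          rcases lt_trichotomy i j with h | h | h
          · simp [h, h.not_gt]
          · subst h; simp
          · simp [h, h.not_gt]⟩
      left_inv := by
        rintro ⟨A, hA⟩
        rw [LieAlgebra.Orthogonal.mem_so] at hA
        ext i j
        have hij := congrFun (congrFun hA i) j
        simp only [Matrix.transpose_apply, Matrix.neg_apply] at hij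
        rcases lt_trichotomy i j with h | h | h
        · simp [h]
        · subst h; simp; linarith
        · simp [h, h.not_gt]; linarith
      right_inv := by
        intro g
        ext ⟨⟨i, j⟩, h⟩
        simp [show i < j from h] }
  have hcard : Fintype.card {p : Fin d × Fin d // p.1 < p.2} = d * (d - 1) / 2 := by
    rw [Fintype.card_subtype, ← Finset.sum_range_id_mul_two d, Nat.mul_div_cancel _ two_pos,
      Finset.card_eq_sum_ones, Finset.sum_filter, Fintype.sum_prod_type_right, Finset.sum_range]
    refine Finset.sum_congr rfl fun j _ => ?_
    rw [← Finset.sum_filter, ← Finset.card_eq_sum_ones]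
    have : (Finset.univ.filter fun x : Fin d => x < j) = Finset.Iio j := by ext; simp
    simp [this]
  rw [dimEuclideanGroup, e.finrank_eq, Module.finrank_fintype_fun_eq_card, hcard]
  cases d with
  | zero => rfl
  | succ k =>
    have h : (k + 1) * (k + 1 + 1) = (k + 1) * (k + 1 - 1) + (k + 1) * 2 := by
      simp; ring
    rw [h, Nat.add_mul_div_right _ _ two_pos]

/-!
The proof works on the set `M` of centered clouds `Y` with pairwise orthogonal rows and Frobenius norm
at most `1` (`orthogonalClouds`), which is as small as the dimension count predicts, and on which a
Deep Sets model can store an invariant function with the square root of the number of grid cells as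
the number of parameters.

*Reduction.* If `U` is an orthogonal factor of `cent X`, then `U⁻¹ * cent X` lies in `M`, and `f`
takes the same value there as at `X`. So it suffices that a Deep Sets model approximates `f` up to
`ε` on `M`; averaging over the frame preserves this (`abs_sub_svdFrameAverage_le`).

*Dimension.* A cloud in `M` consists of `d` pairwise orthogonal vectors in the `(n - 1)`-dimensional
orthogonal complement of the all-ones vector, so `M` has dimension
`K = ∑_{i < d} (n - 1 - i) = n d - d (d + 1) / 2`, and it meets only `O (2 ^ (L * K))` cells of a grid
of mesh `8 / 2 ^ L` (`exists_orthogonal_net`, `exists_card_cells_le`).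

*Networks.* With `2 ^ (-L)` of the order of `ε ^ (1 / α)`, the values of `f` on the cells have to be
stored with about the square root of the number of cells as the number of parameters. This is
possible because the weights are arbitrary real numbers, which can hold long bit strings.

- The inner network extracts the leading `L` bits of the coordinates of a point, packs them into one
  integer, and computes a combination of its powers (`exists_layered_encoder`). The sum over the points
  is an integer whose digits are power sums, hence determines the multiset of cells of the cloud
  (`exists_perm_of_tupleCode_eq`).
- The outer network looks up the value that belongs to this integer. The keys are divided into `A`
  groups of `A` consecutive ones; a sum of `A` step functions selects the real number that encodes
  the group, and the group is decoded bit by bit (`exists_layered_lookup`). Width is bounded and depth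
  is `O (A * (L + e))` for `e`-bit values.
- Being continuous, the bit extraction fails slightly below the upper ends of the cells. So this is
  done for `2 * (d * n) + 1` shifted grids. Each of the `d * n` entries of a cloud is in a bad position
  for at most one of the shifts, so that more than half of the results are correct, and
  their median is accurate (`card_good_shifts`, `exists_layered_median`).
-/

/-! ### Layered functions -/

/-- Affine functionals on `ℝ^ι`. -/
def IsAffineFun {ι : Type} [Fintype ι] (f : (ι → ℝ) → ℝ) : Prop :=
  ∃ (a : ι → ℝ) (b : ℝ), ∀ x, f x = ∑ i, a i * x i + b

theorem isAffineFun_iff {ι : Type} [Fintype ι] {f : (ι → ℝ) → ℝ} :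
    IsAffineFun f ↔ ∀ (c : ℝ) (x y : ι → ℝ), f (c • x + y) = c * (f x - f 0) + f y := by
  classical
  constructor
  · rintro ⟨a, b, h⟩ c x y
    simp only [h, Pi.add_apply, Pi.smul_apply, Pi.zero_apply, smul_eq_mul, mul_add, mul_zero,
      Finset.sum_add_distrib, Finset.sum_const_zero, mul_left_comm _ c, ← Finset.mul_sum]
    ring
  · intro h
    let l : (ι → ℝ) →ₗ[ℝ] ℝ :=
      { toFun := fun x => f x - f 0
        map_add' := fun x y => by have := h 1 x y; simp at this; rw [this]; ring
        map_smul' := fun c x => by have := h c x 0; simp at this; simp [this] }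
    refine ⟨fun i => l (fun j => if i = j then 1 else 0), f 0, fun x => ?_⟩
    have := LinearMap.pi_apply_eq_sum_univ l x
    simp only [smul_eq_mul] at this
    simp only [mul_comm (l _), ← this]
    simp [l]

theorem IsAffineFun.comp {ι κ : Type} [Fintype ι] [Fintype κ] {f : (κ → ℝ) → ℝ}
    (hf : IsAffineFun f) {A : (ι → ℝ) → κ → ℝ} (hA : ∀ k, IsAffineFun fun x => A x k) :
    IsAffineFun fun x => f (A x) := by
  rw [isAffineFun_iff] at hf ⊢
  intro c x y
  have h1 : A (c • x + y) = c • ((-1 : ℝ) • A 0 + A x) + A y := by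
    ext k
    have := isAffineFun_iff.1 (hA k) c x y
    simp only [Pi.add_apply, Pi.smul_apply, smul_eq_mul, this]
    ring
  rw [h1, hf, hf]
  ring

theorem isAffineFun_apply {ι : Type} [Fintype ι] (i : ι) : IsAffineFun fun x : ι → ℝ => x i :=
  isAffineFun_iff.2 fun c x y => by simp

theorem isAffineFun_const {ι : Type} [Fintype ι] (b : ℝ) : IsAffineFun fun _ : ι → ℝ => b :=
  isAffineFun_iff.2 fun c x y => by simp

/-- `Layered H T F` says that `F : ℝ^ι → ℝ^κ` is computed by a ReLU network with exactly `T` hidden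
layers, all of width at most `H`. The coordinates of the layers are indexed by arbitrary finite
types, which keeps block constructions free of index arithmetic. -/
def Layered (H : ℕ) {κ : Type} : ℕ → ∀ {ι : Type} [Fintype ι], ((ι → ℝ) → κ → ℝ) → Prop
  | 0, _, _, F => ∀ k, IsAffineFun fun x => F x k
  | T + 1, ι, _, F => ∃ (η : Type) (_ : Fintype η) (g : η → (ι → ℝ) → ℝ) (G : (η → ℝ) → κ → ℝ),
      Fintype.card η ≤ H ∧ (∀ j, IsAffineFun (g j)) ∧ Layered H T G ∧
        ∀ x, F x = G fun j => max (g j x) 0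

namespace Layered

variable {ι κ μ : Type} [Fintype ι] {H T T' : ℕ}

/-- An affine map in front of a network merges with its first layer. -/
theorem precomp [Fintype κ] {F : (κ → ℝ) → μ → ℝ} (hF : Layered H T F) {A : (ι → ℝ) → κ → ℝ}
    (hA : ∀ k, IsAffineFun fun x => A x k) : Layered H T fun x => F (A x) := by
  cases T with
  | zero => exact fun k => (hF k).comp hA
  | succ T =>
    obtain ⟨η, _, g, G, hη, hg, hG, h⟩ := hF
    exact ⟨η, _, fun j x => g j (A x), G, hη, fun j => (hg j).comp hA, hG, fun x => h _⟩

theorem comp [Fintype κ] {G : (κ → ℝ) → μ → ℝ} (hG : Layered H T' G) :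
    ∀ {T : ℕ} {ι : Type} [Fintype ι] {F : (ι → ℝ) → κ → ℝ},
      Layered H T F → Layered H (T' + T) fun x => G (F x) := by
  intro T
  induction T with
  | zero => exact fun hF => hG.precomp hF
  | succ T ih =>
    rintro ι _ F ⟨η, _, g, F', hη, hg, hF', h⟩
    exact ⟨η, _, g, fun y => G (F' y), hη, hg, ih hF', fun x => by simp only [h]⟩

theorem postcomp [Fintype κ] {F : (ι → ℝ) → κ → ℝ} (hF : Layered H T F) {A : (κ → ℝ) → μ → ℝ}
    (hA : ∀ k, IsAffineFun fun x => A x k) : Layered H T fun x => A (F x) := by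
  have : Layered H 0 A := hA
  simpa using this.comp hF

theorem mono {H' : ℕ} (hH : H ≤ H') :
    ∀ {T : ℕ} {ι : Type} [Fintype ι] {F : (ι → ℝ) → κ → ℝ}, Layered H T F → Layered H' T F := by
  intro T
  induction T with
  | zero => exact fun h => h
  | succ T ih =>
    rintro ι _ F ⟨η, _, g, G, hη, hg, hG, h⟩
    exact ⟨η, _, g, G, hη.trans hH, hg, ih hG, h⟩

theorem iterate {F : (ι → ℝ) → ι → ℝ} (hF : Layered H T F) (p : ℕ) : Layered H (p * T) F^[p] := by
  induction p with
  | zero =>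
    simp only [Nat.zero_mul]
    exact fun k => isAffineFun_apply k
  | succ p ih =>
    rw [Nat.succ_mul]
    exact ih.comp hF

theorem foldl {β : Type} {F : (ι → ℝ) → β → ι → ℝ} (l : List β)
    (hF : ∀ b ∈ l, Layered H T fun x => F x b) :
    Layered H (l.length * T) fun x => l.foldl F x := by
  induction l with
  | nil =>
    simp only [List.length_nil, Nat.zero_mul]
    exact fun k => isAffineFun_apply k
  | cons b l ih =>
    rw [List.length_cons, Nat.succ_mul]
    exact (ih fun b' hb' => hF b' (List.mem_cons_of_mem _ hb')).comp (hF b List.mem_cons_self)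

/-- One layer of register updates: every output is jointly affine in the inputs and in the values
of the activated affine functionals `g`. The inputs pass through the layer as
`x = max x 0 - max (-x) 0`. -/
theorem step {η : Type} [Fintype η] (g : η → (ι → ℝ) → ℝ) (hg : ∀ j, IsAffineFun (g j))
    (o : κ → (ι → ℝ) → (η → ℝ) → ℝ)
    (ho : ∀ k c x y u v, o k (c • x + y) (c • u + v) = c * (o k x u - o k 0 0) + o k y v)
    (hH : 2 * Fintype.card ι + Fintype.card η ≤ H) :
    Layered H 1 fun x k => o k x fun j => max (g j x) 0 := by
  refine ⟨(ι ⊕ ι) ⊕ η, inferInstance,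
    Sum.elim (Sum.elim (fun i x => x i) (fun i x => -x i)) g,
    fun y k => o k (fun i => y (.inl (.inl i)) - y (.inl (.inr i))) (fun j => y (.inr j)),
    ?_, ?_, ?_, ?_⟩
  · simpa [two_mul] using hH
  · rintro ((i | i) | j)
    · exact isAffineFun_apply i
    · exact isAffineFun_iff.2 fun c x y => by simp; ring
    · exact hg j
  · intro k
    refine isAffineFun_iff.2 fun c x y => ?_
    have h := ho k c (fun i => x (.inl (.inl i)) - x (.inl (.inr i)))
      (fun i => y (.inl (.inl i)) - y (.inl (.inr i))) (fun j => x (.inr j)) (fun j => y (.inr j))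
    have h0 : o k (fun _ => (0 : ℝ) - 0) (fun _ => 0) = o k 0 0 := by
      simp only [sub_zero]; rfl
    simp only [Pi.zero_apply, h0, ← h]
    congr 1
    ext i
    simp; ring
  · intro x
    ext k
    simp only [Sum.elim_inl, Sum.elim_inr]
    congr 1
    ext i
    rcases le_total (x i) 0 with h | h
    · simp [h]
    · simp [h]

/-- Layered functions with equally many layers can be run in parallel. -/
theorem pi {S : Type} [Fintype S] : ∀ {T : ℕ} {ι κ : S → Type} [∀ s, Fintype (ι s)]
    {F : ∀ s, (ι s → ℝ) → κ s → ℝ}, (∀ s, Layered H T (F s)) →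
    Layered (Fintype.card S * H) T
      fun (x : (Σ s, ι s) → ℝ) (k : Σ s, κ s) => F k.1 (fun i => x ⟨k.1, i⟩) k.2 := by
  intro T
  induction T with
  | zero => exact fun {ι κ} _ F hF k => (hF k.1 k.2).comp fun i => isAffineFun_apply _
  | succ T ih =>
    intro ι κ _ F hF
    choose η hη g G hcard hg hG h using hF
    refine ⟨Σ s, η s, inferInstance, fun j x => g j.1 j.2 fun i => x ⟨j.1, i⟩, _, ?_,
      fun j => (hg j.1 j.2).comp fun i => isAffineFun_apply _, ih hG, fun x => ?_⟩
    · rw [Fintype.card_sigma]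
      exact (Finset.sum_le_card_nsmul _ _ H fun s _ => hcard s).trans (by simp)
    · ext k
      simp only [h]

/-- Conversion to a network, with a bound for the number of parameters. -/
theorem exists_network {b : ℕ} : ∀ {T a : ℕ} {F : (Fin a → ℝ) → Fin b → ℝ}, Layered H T F →
    a ≤ H → b ≤ H → ∃ N : ReLUNetwork a b, N.eval = F ∧ N.numParams ≤ (T + 1) * (H * H + H) := by
  intro T
  induction T with
  | zero =>
    intro a F hF ha hb
    choose W c h using hF
    refine ⟨.output (.of W) c, ?_, ?_⟩
    · ext x k
      simp [ReLUNetwork.eval, Matrix.mulVec, dotProduct, h]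
    · simp only [ReLUNetwork.numParams, zero_add, one_mul]
      gcongr
  | succ T ih =>
    rintro a F ⟨η, _, g, G, hη, hg, hG, h⟩ ha hb
    let e := Fintype.equivFin η
    obtain ⟨N, hN, hP⟩ := ih (hG.precomp (A := fun (x : Fin _ → ℝ) j => x (e j))
      fun j => isAffineFun_apply _) hη hb
    choose W c hW using hg
    refine ⟨.hidden (.of fun j => W (e.symm j)) (fun j => c (e.symm j)) N, ?_, ?_⟩
    · ext x k
      simp [ReLUNetwork.eval, Matrix.mulVec, dotProduct, h, hW, hN]
    · simp only [ReLUNetwork.numParams]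
      rw [Nat.succ_mul (T + 1), add_comm]
      gcongr

end Layered

/-! ### Bit extraction -/

section BitExtraction

variable {ι : Type} [DecidableEq ι]

/-- One step of bit extraction on the registers `t`, `acc`, `z`. If `b` is the leading binary digit
of `x t ∈ [0, 1)`, then `x t` becomes `2 * x t - b` and `x acc` becomes `2 * x acc + b * x z`,
provided that `x t` is not slightly below `1 / 2` (in terms of the large parameter `s`). -/
noncomputable def bitStep (s : ℝ) (t acc z : ι) (x : ι → ℝ) : ι → ℝ :=
  Function.update
    (Function.update x t
      (2 * x t - (max (s * (x t - 1 / 2) + 1) 0 - max (s * (x t - 1 / 2)) 0)))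
    acc (2 * x acc + (max (s * (x t - 1 / 2) + x z) 0 - max (s * (x t - 1 / 2)) 0))

theorem layered_bitStep [Fintype ι] {H : ℕ} (hH : 2 * Fintype.card ι + 3 ≤ H) (s : ℝ)
    (t acc z : ι) : Layered H 1 (bitStep s t acc z) := by
  have := Layered.step (H := H) (η := Fin 3) (κ := ι)
    ![fun x : ι → ℝ => s * (x t - 1 / 2) + 1, fun x => s * (x t - 1 / 2),
      fun x => s * (x t - 1 / 2) + x z]
    (by
      intro j
      fin_cases j <;> refine isAffineFun_iff.2 fun c x y => ?_ <;> simp <;> ring)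
    (fun k x u => Function.update (Function.update x t (2 * x t - (u 0 - u 1))) acc
      (2 * x acc + (u 2 - u 1)) k)
    (by
      intro k c x y u v
      simp only [Function.update_apply, Pi.add_apply, Pi.smul_apply, Pi.zero_apply, smul_eq_mul]
      split_ifs <;> ring)
    (by simpa using hH)
  exact this

/-- Iterated bit extraction: the `p` leading binary digits `v` of `x t` are removed from it, and
`v * x z` is added to the shifted accumulator. The last two hypotheses say that none of the steps
meets the transition zone of the approximate step functions, and that `x z` is below their
steepness. -/
theorem bitStep_iterate {s : ℝ} (hs : 0 ≤ s) {t acc z : ι} (hta : t ≠ acc) (htz : t ≠ z) (haz : acc ≠ z) :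
    ∀ (p v : ℕ) (t' : ℝ) (x : ι → ℝ), v < 2 ^ p → x t = (v + t') / 2 ^ p → 0 ≤ t' → 0 ≤ x z →
      2 ^ p ≤ s * (1 - t') → 2 ^ p * x z ≤ s * (1 - t') →
      (bitStep s t acc z)^[p] x =
        Function.update (Function.update x t t') acc (2 ^ p * x acc + v * x z) := by
  intro p
  induction p with
  | zero =>
    intro v t' x hv ht _ _ _ _
    have hv0 : v = 0 := by simpa using hv
    subst hv0
    simp at ht
    ext i
    simp [Function.update_apply]
    split_ifs <;> simp_all
  | succ p ih =>
    intro v t' x hv ht ht0 hz h1 h2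
    have hp : (0 : ℝ) < 2 ^ p := by positivity
    have hst : 0 < s * (1 - t') := lt_of_lt_of_le (by positivity) h1
    have ht1 : x t * 2 ^ (p + 1) = v + t' := by rw [ht]; field_simp
    rw [Function.iterate_succ_apply]
    rcases lt_or_ge v (2 ^ p) with hlt | hge
    · -- the leading digit is `0`
      have hv1 : (v : ℝ) + 1 ≤ 2 ^ p := by exact_mod_cast hlt
      have hb : bitStep s t acc z x =
          Function.update (Function.update x t (2 * x t)) acc (2 * x acc) := by
        have hgap : s * (x t - 1 / 2) * 2 ^ (p + 1) ≤ - (s * (1 - t')) := by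
          have : (x t - 1 / 2) * 2 ^ (p + 1) ≤ -(1 - t') := by
            rw [sub_mul, ht1, pow_succ]; linarith
          nlinarith
        have hy1 : s * (x t - 1 / 2) + 1 ≤ 0 := by
          have : (s * (x t - 1 / 2) + 1) * 2 ^ (p + 1) ≤ 0 := by linarith
          exact nonpos_of_mul_nonpos_left this (by positivity)
        have hyz : s * (x t - 1 / 2) + x z ≤ 0 := by
          have : (s * (x t - 1 / 2) + x z) * 2 ^ (p + 1) ≤ 0 := by linarith
          exact nonpos_of_mul_nonpos_left this (by positivity)
        have hy : s * (x t - 1 / 2) ≤ 0 := by linarith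
        rw [bitStep, max_eq_right hy1, max_eq_right hyz, max_eq_right hy, sub_zero, sub_zero,
          add_zero]
      rw [hb, ih v t' _ hlt (by
        rw [Function.update_of_ne hta, Function.update_self, eq_div_iff hp.ne', ← ht1, pow_succ]
        ring) ht0 (by rwa [Function.update_of_ne haz.symm, Function.update_of_ne htz.symm])
        (le_trans (by rw [pow_succ]; linarith) h1) (by
          rw [Function.update_of_ne haz.symm, Function.update_of_ne htz.symm]
          refine le_trans ?_ h2
          rw [pow_succ]
          nlinarith)]
      ext i
      simp only [Function.update_apply, if_neg haz.symm, if_neg htz.symm, if_true]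
      split_ifs
      · rw [pow_succ]; ring
      · rfl
      · rfl
    · -- the leading digit is `1`
      obtain ⟨v', rfl⟩ := Nat.exists_eq_add_of_le hge
      push_cast at ht1
      have hv'0 : (0 : ℝ) ≤ v' := Nat.cast_nonneg _
      have hb : bitStep s t acc z x =
          Function.update (Function.update x t (2 * x t - 1)) acc (2 * x acc + x z) := by
        have hy : 0 ≤ s * (x t - 1 / 2) := by
          refine mul_nonneg hs ?_
          have : 0 ≤ (x t - 1 / 2) * 2 ^ (p + 1) := by
            rw [sub_mul, ht1, pow_succ]; linarith
          exact nonneg_of_mul_nonneg_left this (by positivity)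
        rw [bitStep, max_eq_left hy, max_eq_left (add_nonneg hy hz),
          max_eq_left (add_nonneg hy zero_le_one), add_sub_cancel_left, add_sub_cancel_left]
      rw [hb, ih v' t' _ (by rw [pow_succ] at hv; omega) (by
        rw [Function.update_of_ne hta, Function.update_self, eq_div_iff hp.ne']
        rw [pow_succ] at ht1
        linear_combination ht1) ht0
        (by rwa [Function.update_of_ne haz.symm, Function.update_of_ne htz.symm])
        (le_trans (by rw [pow_succ]; linarith) h1) (by
          rw [Function.update_of_ne haz.symm, Function.update_of_ne htz.symm]
          refine le_trans ?_ h2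
          rw [pow_succ]
          nlinarith)]
      ext i
      simp only [Function.update_apply, if_neg haz.symm, if_neg htz.symm, if_true]
      split_ifs
      · push_cast; rw [pow_succ]; ring
      · rfl
      · rfl

end BitExtraction

/-! ### Lookup tables -/

/-- The piecewise linear function that is the identity on `[0, E - 1]` and vanishes on
`(-∞, 0] ∪ [E, ∞)`. -/
noncomputable def window (E y : ℝ) : ℝ :=
  max y 0 - E * max (y - (E - 1)) 0 + (E - 1) * max (y - E) 0

theorem window_of_nonpos {E y : ℝ} (hE : 1 ≤ E) (hy : y ≤ 0) : window E y = 0 := by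
  rw [window, max_eq_right hy, max_eq_right (by linarith), max_eq_right (by linarith)]
  ring

theorem window_of_ge {E y : ℝ} (hE : 1 ≤ E) (hy : E ≤ y) : window E y = 0 := by
  rw [window, max_eq_left (by linarith), max_eq_left (by linarith), max_eq_left (by linarith)]
  ring

theorem window_of_mem {E y : ℝ} (hy : 0 ≤ y) (hyE : y ≤ E - 1) : window E y = y := by
  rw [window, max_eq_left hy, max_eq_right (by linarith), max_eq_right (by linarith)]
  ring

/-- The real number whose base `2 ^ p` digits after the point are `v (k - 1), …, v 0`; it lies in
`[0, 1)` if all `v j` are below `2 ^ p`. -/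
noncomputable def digitCode (p : ℕ) (v : ℕ → ℕ) : ℕ → ℝ
  | 0 => 0
  | k + 1 => (v k + digitCode p v k) / 2 ^ p

theorem digitCode_nonneg (p : ℕ) (v : ℕ → ℕ) (k : ℕ) : 0 ≤ digitCode p v k := by
  induction k with
  | zero => exact le_rfl
  | succ k ih => rw [digitCode]; positivity

theorem one_le_mul_one_sub_digitCode {p : ℕ} {v : ℕ → ℕ} (hv : ∀ k, v k < 2 ^ p) (k : ℕ) :
    1 ≤ 2 ^ (p * k) * (1 - digitCode p v k) := by
  induction k with
  | zero => simp [digitCode]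
  | succ k ih =>
    have h1 : (v k : ℝ) + 1 ≤ 2 ^ p := by exact_mod_cast hv k
    have hp : (0 : ℝ) < 2 ^ p := by positivity
    have h2 : (1 : ℝ) - digitCode p v k ≤ 2 ^ p * (1 - digitCode p v (k + 1)) := by
      rw [digitCode, mul_sub, mul_div_cancel₀ _ hp.ne']
      linarith
    calc (1 : ℝ) ≤ 2 ^ (p * k) * (1 - digitCode p v k) := ih
      _ ≤ 2 ^ (p * k) * (2 ^ p * (1 - digitCode p v (k + 1))) := by gcongr
      _ = _ := by rw [Nat.mul_succ, pow_add, mul_assoc]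

/-- Adds `Δ` to register `1` if the natural number in register `0` is at least `c`. -/
noncomputable def jumpStep (x : Fin 5 → ℝ) (cΔ : ℝ × ℝ) : Fin 5 → ℝ :=
  Function.update x 1 (x 1 + cΔ.2 * (max (x 0 - cΔ.1 + 1) 0 - max (x 0 - cΔ.1) 0))

theorem layered_jumpStep (cΔ : ℝ × ℝ) : Layered 13 1 fun x => jumpStep x cΔ := by
  exact Layered.step (H := 13) (η := Fin 2) (κ := Fin 5)
    ![fun x : Fin 5 → ℝ => x 0 - cΔ.1 + 1, fun x => x 0 - cΔ.1]
    (by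
      intro j
      fin_cases j <;> refine isAffineFun_iff.2 fun c x y => ?_ <;> simp <;> ring)
    (fun k x u => Function.update x 1 (x 1 + cΔ.2 * (u 0 - u 1)) k)
    (by
      intro k c x y u v
      simp only [Function.update_apply, Pi.add_apply, Pi.smul_apply, Pi.zero_apply, smul_eq_mul]
      split_ifs <;> ring)
    (by simp)

/-- Compares the entry in register `2`, of the form `key * E + label`, with the key in register `0`;
if they match, adds the label to register `4`. -/
noncomputable def matchStep (E : ℝ) (x : Fin 5 → ℝ) : Fin 5 → ℝ :=
  Function.update (Function.update x 4 (x 4 + window E (x 2 - E * x 0))) 2 0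

theorem layered_matchStep (E : ℝ) : Layered 13 1 (matchStep E) := by
  exact Layered.step (H := 13) (η := Fin 3) (κ := Fin 5)
    ![fun x : Fin 5 → ℝ => x 2 - E * x 0, fun x => x 2 - E * x 0 - (E - 1),
      fun x => x 2 - E * x 0 - E]
    (by
      intro j
      fin_cases j <;> refine isAffineFun_iff.2 fun c x y => ?_ <;> simp <;> ring)
    (fun k x u => Function.update (Function.update x 4 (x 4 + (u 0 - E * u 1 + (E - 1) * u 2))) 2
      0 k)
    (by
      intro k c x y u v
      simp only [Function.update_apply, Pi.add_apply, Pi.smul_apply, Pi.zero_apply, smul_eq_mul]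
      split_ifs <;> ring)
    (by simp)

theorem foldl_jumpStep (z : ℕ) (l : List (ℕ × ℝ)) (x : Fin 5 → ℝ) (hx : x 0 = z) :
    (l.map fun q => ((q.1 : ℝ), q.2)).foldl jumpStep x =
      Function.update x 1 (x 1 + (l.map fun q => if q.1 ≤ z then q.2 else 0).sum) := by
  induction l generalizing x with
  | nil => simp
  | cons q l ih =>
    have h : jumpStep x ((q.1 : ℝ), q.2) =
        Function.update x 1 (x 1 + if q.1 ≤ z then q.2 else 0) := by
      rw [jumpStep, hx]
      split_ifs with hq
      · have : (q.1 : ℝ) ≤ z := by exact_mod_cast hq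
        rw [max_eq_left (by simp; linarith), max_eq_left (by simpa using this)]
        congr 2
        simp
      · have : (z : ℝ) + 1 ≤ q.1 := by exact_mod_cast not_le.1 hq
        rw [max_eq_right (by simp; linarith), max_eq_right (by simp; linarith)]
        simp
    rw [List.map_cons, List.foldl_cons, h, ih _ (by simpa using hx)]
    simp [add_assoc]

/-- One round of a table scan: extract the next entry and compare it with the key. -/
noncomputable def scanRound (s E : ℝ) (p : ℕ) (x : Fin 5 → ℝ) : Fin 5 → ℝ :=
  matchStep E ((bitStep s 1 2 3)^[p] x)

theorem scanRound_iterate {s E : ℝ} {p A : ℕ} {v : ℕ → ℕ} (hv : ∀ k, v k < 2 ^ p)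
    (hs : 2 ^ (p * A) ≤ s) :
    ∀ k ≤ A, ∀ x : Fin 5 → ℝ, x 1 = digitCode p v k → x 2 = 0 → x 3 = 1 →
      (scanRound s E p)^[k] x 4 = x 4 + ∑ j ∈ Finset.range k, window E (v j - E * x 0) := by
  intro k
  induction k with
  | zero => intro _ x _ _ _; simp
  | succ k ih =>
    intro hk x h1 h2 h3
    have hs0 : (0 : ℝ) ≤ s := le_trans (by positivity) hs
    have hpow : (2 : ℝ) ^ p ≤ s * (1 - digitCode p v k) := by
      have h4 := one_le_mul_one_sub_digitCode hv k
      have h5 : 0 ≤ 1 - digitCode p v k := by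
        by_contra hc
        have : (0 : ℝ) < 2 ^ (p * k) := by positivity
        nlinarith
      calc (2 : ℝ) ^ p ≤ 2 ^ p * (2 ^ (p * k) * (1 - digitCode p v k)) :=
            le_mul_of_one_le_right (by positivity) h4
        _ = 2 ^ (p * (k + 1)) * (1 - digitCode p v k) := by
            rw [Nat.mul_succ, pow_add]; ring
        _ ≤ 2 ^ (p * A) * (1 - digitCode p v k) := by
            gcongr
            exact one_le_two
        _ ≤ _ := by gcongr
    have hround : scanRound s E p x = Function.update (Function.update x 1 (digitCode p v k)) 4
        (x 4 + window E (v k - E * x 0)) := by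
      rw [scanRound, bitStep_iterate hs0 (by decide) (by decide) (by decide) p (v k)
        (digitCode p v k) x (hv k) (by rw [h1, digitCode]) (digitCode_nonneg p v k)
        (by rw [h3]; exact zero_le_one) hpow (by rw [h3, mul_one]; exact hpow), h2, h3]
      ext i
      fin_cases i <;> simp [matchStep, Function.update, h2]
    rw [Function.iterate_succ_apply, hround, ih (by omega) _ (by simp [Function.update])
      (by simpa [Function.update] using h2) (by simpa [Function.update] using h3),
      Finset.sum_range_succ]
    simp [Function.update]
    ring

/-- The superlevel sets of a monotone function on `{0, …, R - 1}` are cut out by thresholds. -/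
theorem exists_threshold {r : ℕ → ℕ} (hr : Monotone r) (k R : ℕ) :
    ∃ c : ℕ, ∀ z < R, (c ≤ z ↔ k ≤ r z) := by
  classical
  by_cases h : ∃ z, k ≤ r z
  · exact ⟨Nat.find h, fun z _ => ⟨fun hz => (Nat.find_spec h).trans (hr hz),
      fun hz => Nat.find_min' h hz⟩⟩
  · exact ⟨R, fun z hz => ⟨fun h' => absurd hz (not_lt.2 h'), fun h' => absurd ⟨z, h'⟩ h⟩⟩

/-- A table with at most `A ^ 2` keys of `w` bits and labels of `e` bits is looked up exactly by a
network of bounded width and depth `O (A * (w + e))`: the keys are divided into `A` groups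
of `A` consecutive ones; the network selects a real number that encodes the whole group of the given
key together with the labels, and decodes it. -/
theorem exists_layered_lookup (S : Finset ℕ) (l : ℕ → ℕ) {w e A : ℕ} (hS : ∀ z ∈ S, z < 2 ^ w)
    (hl : ∀ z ∈ S, l z < 2 ^ e) (hA : S.card ≤ A * A) :
    ∃ F : (Unit → ℝ) → Unit → ℝ, Layered 13 (A * (w + e + 1) + A) F ∧
      ∀ z ∈ S, F (fun _ => z) = fun _ => (l z : ℝ) := by
  classical
  set p := w + e
  -- the rank of a key; the key of rank `g * A + k` is entry `k` of group `g`
  let r : ℕ → ℕ := fun z => (S.filter (· < z)).card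
  have hr : Monotone r := fun a b hab =>
    Finset.card_le_card fun x hx => by
      rw [Finset.mem_filter] at hx ⊢; exact ⟨hx.1, hx.2.trans_le hab⟩
  have hr_lt : ∀ a ∈ S, ∀ b, a < b → r a < r b := fun a ha b hab =>
    Finset.card_lt_card (Finset.ssubset_iff_of_subset (fun x hx => by
      rw [Finset.mem_filter] at hx ⊢; exact ⟨hx.1, hx.2.trans hab⟩) |>.2
      ⟨a, by simp [ha, hab], by simp⟩)
  have hr_inj : ∀ a ∈ S, ∀ b ∈ S, r a = r b → a = b := by
    intro a ha b hb hab
    rcases lt_trichotomy a b with h | h | h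
    · exact absurd hab (hr_lt a ha b h).ne
    · exact h
    · exact absurd hab (hr_lt b hb a h).ne'
  have hr_card : ∀ z ∈ S, r z < A * A := fun z hz =>
    lt_of_lt_of_le (Finset.card_lt_card (Finset.ssubset_iff_of_subset
      (Finset.filter_subset _ _) |>.2 ⟨z, hz, by simp⟩)) hA
  -- the table; missing entries are filled up by `0`, which carries the label `0`
  let v : ℕ → ℕ → ℕ := fun g k =>
    if h : ∃ z ∈ S, r z = g * A + k then h.choose * 2 ^ e + l h.choose else 0
  have hv : ∀ g k, v g k < 2 ^ p := by
    intro g k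
    simp only [v]
    split_ifs with h
    · obtain ⟨hz, -⟩ := h.choose_spec
      have h1 := hS _ hz
      have h2 := hl _ hz
      calc _ < h.choose * 2 ^ e + 2 ^ e := by omega
        _ = (h.choose + 1) * 2 ^ e := by ring
        _ ≤ 2 ^ w * 2 ^ e := Nat.mul_le_mul_right _ h1
        _ = 2 ^ p := (pow_add _ _ _).symm
    · positivity
  choose c hc using fun k => exists_threshold hr k (2 ^ w)
  -- the register `1` holds `U 0` at first and jumps from `U g` to `U (g + 1)` at the first key of
  -- group `g + 1`
  let U : ℕ → ℝ := fun g => digitCode p (v g) A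
  let jumps : List (ℕ × ℝ) := (List.range A).map fun g => (c ((g + 1) * A), U (g + 1) - U g)
  let s : ℝ := 2 ^ (p * A)
  let init : (Unit → ℝ) → Fin 5 → ℝ := fun y => ![y (), U 0, 0, 1, 0]
  refine ⟨fun y _ => (scanRound s (2 ^ e) p)^[A]
    ((jumps.map fun q => ((q.1 : ℝ), q.2)).foldl jumpStep (init y)) 4, ?_, ?_⟩
  · have hinit : ∀ i, IsAffineFun fun y => init y i := by
      intro i
      refine isAffineFun_iff.2 fun c x y => ?_
      fin_cases i <;> simp [init]
    have h1 := Layered.foldl (H := 13) (T := 1) (F := jumpStep)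
      (jumps.map fun q => ((q.1 : ℝ), q.2)) fun q _ => layered_jumpStep q
    have h2 : Layered 13 (p + 1) (scanRound s (2 ^ e) p) := by
      have h3 := (layered_bitStep (ι := Fin 5) (H := 13) (by simp) s 1 2 3).iterate p
      rw [mul_one] at h3
      rw [add_comm]
      exact (layered_matchStep _).comp h3
    have h3 := ((h2.iterate A).comp (h1.precomp hinit)).postcomp (μ := Unit)
      (A := fun x _ => x 4) fun _ => isAffineFun_apply _
    simpa [jumps] using h3
  · intro z hz
    have hgA : r z / A < A := Nat.div_lt_of_lt_mul (hr_card z hz)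
    have hApos : 0 < A := (Nat.zero_le _).trans_lt hgA
    have hsum : (jumps.map fun q => if q.1 ≤ z then q.2 else 0).sum = U (r z / A) - U 0 := by
      simp only [jumps, List.map_map, Function.comp_def]
      rw [← List.sum_toFinset _ List.nodup_range, List.toFinset_range,
        ← Finset.sum_range_sub U, ← Finset.sum_filter]
      congr 1
      ext g
      simp only [Finset.mem_filter, Finset.mem_range, hc _ z (hS z hz), ← Nat.le_div_iff_mul_le hApos]
      omega
    ext
    have hE : (1 : ℝ) ≤ 2 ^ e := one_le_pow₀ one_le_two
    dsimp only
    rw [foldl_jumpStep z _ _ (by simp [init]), hsum,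
      scanRound_iterate (hv (r z / A)) le_rfl A le_rfl _ (by simp [init, U]) (by simp [init])
        (by simp [init]), Finset.sum_eq_single_of_mem (r z % A)
          (Finset.mem_range.2 (Nat.mod_lt _ hApos))]
    · have h : ∃ z' ∈ S, r z' = r z / A * A + r z % A := ⟨z, hz, by rw [Nat.div_add_mod']⟩
      have hch : h.choose = z := hr_inj _ h.choose_spec.1 _ hz (by
        rw [h.choose_spec.2, Nat.div_add_mod'])
      have hvz : v (r z / A) (r z % A) = z * 2 ^ e + l z := by
        simp only [v]
        rw [dif_pos h, hch]
      rw [hvz]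
      have hlz : (l z : ℝ) + 1 ≤ 2 ^ e := by exact_mod_cast hl z hz
      have : (((z * 2 ^ e + l z : ℕ) : ℝ) - 2 ^ e * z) = l z := by push_cast; ring
      simp [init, Function.update]
      rw [show ((z : ℝ) * 2 ^ e + l z - 2 ^ e * z) = l z by ring]
      exact window_of_mem (Nat.cast_nonneg _) (by linarith)
    · intro k hk hkne
      have hx0 : (Function.update (init fun _ => (z : ℝ)) 1
        ((init fun _ => (z : ℝ)) 1 + (U (r z / A) - U 0))) 0 = z := by simp [init]
      rw [hx0]
      by_cases h : ∃ z' ∈ S, r z' = r z / A * A + k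
      · have hvz : v (r z / A) k = h.choose * 2 ^ e + l h.choose := by
          simp only [v]
          rw [dif_pos h]
        obtain ⟨hmem, hrk⟩ := h.choose_spec
        set z' := h.choose
        have hne : z' ≠ z := by
          intro heq
          rw [heq] at hrk
          have := Nat.div_add_mod' (r z) A
          omega
        rw [hvz]
        have hlz : (l z' : ℝ) + 1 ≤ 2 ^ e := by exact_mod_cast hl z' hmem
        have hl0 : (0 : ℝ) ≤ l z' := Nat.cast_nonneg _
        push_cast
        rcases lt_or_gt_of_ne hne with hlt | hgt
        · have : (z' : ℝ) + 1 ≤ z := by exact_mod_cast hlt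
          exact window_of_nonpos hE (by nlinarith)
        · have : (z : ℝ) + 1 ≤ z' := by exact_mod_cast hgt
          exact window_of_ge hE (by nlinarith)
      · have hvz : v (r z / A) k = 0 := by
          simp only [v]
          rw [dif_neg h]
        rw [hvz]
        exact window_of_nonpos hE (by simp)

/-! ### Medians -/

theorem le_foldl_min {S : Type} {a hi : ℝ} {v : S → ℝ} (l : List S) (h0 : a ≤ hi) (h : ∀ i ∈ l, a ≤ v i) :
    a ≤ l.foldl (fun c i => min c (v i)) hi := by
  induction l generalizing hi with
  | nil => exact h0
  | cons i l ih =>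
    exact ih (le_min h0 (h i List.mem_cons_self)) fun j hj => h j (List.mem_cons_of_mem _ hj)

theorem foldl_min_le {S : Type} {b hi : ℝ} {v : S → ℝ} (l : List S) (h : hi ≤ b ∨ ∃ i ∈ l, v i ≤ b) :
    l.foldl (fun c i => min c (v i)) hi ≤ b := by
  induction l generalizing hi with
  | nil => simpa using h
  | cons i l ih =>
    refine ih ?_
    rcases h with h | ⟨j, hj, hb⟩
    · exact .inl (min_le_of_left_le h)
    · rcases List.mem_cons.1 hj with rfl | hj
      · exact .inl (min_le_of_right_le hb)
      · exact .inr ⟨j, hj, hb⟩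

section Median

variable {S : Type} [DecidableEq S]

/-- Replaces the register `inr false` by its minimum with the input `i`. -/
noncomputable def minStep (x : S ⊕ Bool → ℝ) (i : S) : S ⊕ Bool → ℝ :=
  Function.update x (.inr false) (x (.inr false) - max (x (.inr false) - x (.inl i)) 0)

/-- Replaces the register `inr true` by its maximum with the register `inr false`. -/
noncomputable def maxStep (x : S ⊕ Bool → ℝ) : S ⊕ Bool → ℝ :=
  Function.update x (.inr true) (x (.inr false) + max (x (.inr true) - x (.inr false)) 0)

/-- Replaces the register `inr true` by its maximum with the minimum of `hi` and of the inputs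
in `l`. -/
noncomputable def maxMinRound (hi : ℝ) (x : S ⊕ Bool → ℝ) (l : List S) : S ⊕ Bool → ℝ :=
  maxStep (l.foldl minStep (Function.update x (.inr false) hi))

theorem layered_minStep [Fintype S] (i : S) :
    Layered (2 * (Fintype.card S + 2) + 1) 1 fun x : S ⊕ Bool → ℝ => minStep x i := by
  exact Layered.step (η := Unit) (κ := S ⊕ Bool)
    (fun _ (x : S ⊕ Bool → ℝ) => x (.inr false) - x (.inl i))
    (fun j => isAffineFun_iff.2 fun c x y => by simp; ring)
    (fun k x u => Function.update x (.inr false) (x (.inr false) - u ()) k)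
    (by
      intro k c x y u v
      simp only [Function.update_apply, Pi.add_apply, Pi.smul_apply, Pi.zero_apply, smul_eq_mul]
      split_ifs <;> ring)
    (by simp)

theorem layered_maxStep [Fintype S] :
    Layered (2 * (Fintype.card S + 2) + 1) 1 (maxStep (S := S)) := by
  exact Layered.step (η := Unit) (κ := S ⊕ Bool)
    (fun _ (x : S ⊕ Bool → ℝ) => x (.inr true) - x (.inr false))
    (fun j => isAffineFun_iff.2 fun c x y => by simp; ring)
    (fun k x u => Function.update x (.inr true) (x (.inr false) + u ()) k)
    (by
      intro k c x y u v
      simp only [Function.update_apply, Pi.add_apply, Pi.smul_apply, Pi.zero_apply, smul_eq_mul]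
      split_ifs <;> ring)
    (by simp)

theorem layered_maxMinRound [Fintype S] (hi : ℝ) (l : List S) :
    Layered (2 * (Fintype.card S + 2) + 1) (1 + l.length) fun x => maxMinRound hi x l := by
  have h0 : ∀ j, IsAffineFun fun x : S ⊕ Bool → ℝ => Function.update x (.inr false) hi j :=
    fun j => isAffineFun_iff.2 fun c x y => by
      simp only [Function.update_apply, Pi.add_apply, Pi.smul_apply, Pi.zero_apply, smul_eq_mul]
      split_ifs <;> ring
  have := layered_maxStep.comp ((Layered.foldl l fun i _ => layered_minStep i).precomp h0)
  rw [mul_one] at this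
  exact this

theorem foldl_minStep (l : List S) (x : S ⊕ Bool → ℝ) :
    l.foldl minStep x =
      Function.update x (.inr false) (l.foldl (fun c i => min c (x (.inl i))) (x (.inr false))) := by
  induction l generalizing x with
  | nil => simp
  | cons i l ih =>
    have : x (.inr false) - max (x (.inr false) - x (.inl i)) 0 =
        min (x (.inr false)) (x (.inl i)) := by
      rcases le_total (x (.inr false)) (x (.inl i)) with h | h
      · rw [min_eq_left h, max_eq_right (by linarith), sub_zero]
      · rw [min_eq_right h, max_eq_left (by linarith), sub_sub_cancel]
    rw [List.foldl_cons, ih, List.foldl_cons, minStep, this]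
    simp

theorem maxMinRound_eq (hi : ℝ) (x : S ⊕ Bool → ℝ) (l : List S) :
    maxMinRound hi x l =
      Function.update (Function.update x (.inr false) (l.foldl (fun c i => min c (x (.inl i))) hi))
        (.inr true) (max (x (.inr true)) (l.foldl (fun c i => min c (x (.inl i))) hi)) := by
  rw [maxMinRound, foldl_minStep, maxStep]
  simp only [Function.update_self, Function.update_idem, ne_eq, reduceCtorEq, not_false_eq_true,
    Function.update_of_ne, Sum.inr.injEq, Bool.true_eq_false]
  congr 1
  rcases le_total (x (.inr true)) (l.foldl (fun c i => min c (x (.inl i))) hi) with h | h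
  · rw [max_eq_right h, max_eq_right (by linarith), add_zero]
  · rw [max_eq_left h, max_eq_left (by linarith)]; ring

theorem foldl_maxMinRound (hi : ℝ) (L : List (List S)) (x : S ⊕ Bool → ℝ) :
    x (.inr true) ≤ L.foldl (maxMinRound hi) x (.inr true) ∧
    (∀ l ∈ L, l.foldl (fun c i => min c (x (.inl i))) hi ≤
      L.foldl (maxMinRound hi) x (.inr true)) ∧
    ∀ b, x (.inr true) ≤ b → (∀ l ∈ L, l.foldl (fun c i => min c (x (.inl i))) hi ≤ b) →
      L.foldl (maxMinRound hi) x (.inr true) ≤ b := by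
  induction L generalizing x with
  | nil => simp
  | cons l L ih =>
    obtain ⟨h1, h2, h3⟩ := ih (maxMinRound hi x l)
    have e1 : ∀ i, maxMinRound hi x l (.inl i) = x (.inl i) := fun i => by simp [maxMinRound_eq]
    have e2 : maxMinRound hi x l (.inr true) =
        max (x (.inr true)) (l.foldl (fun c i => min c (x (.inl i))) hi) := by
      simp [maxMinRound_eq]
    simp only [e1, e2] at h1 h2 h3
    refine ⟨(le_max_left _ _).trans h1, ?_, fun b hb hL => ?_⟩
    · intro l' hl'
      rcases List.mem_cons.1 hl' with rfl | hl'
      · exact (le_max_right _ _).trans h1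
      · exact h2 l' hl'
    · exact h3 b (max_le hb (hL l List.mem_cons_self)) fun l' hl' =>
        hL l' (List.mem_cons_of_mem _ hl')

/-- The median of at most `2 * k + 1` numbers, written as the maximum over the sets of `k + 1`
indices of the minimum over the set: it lies in `[a, b]` as soon as `k + 1` of the
numbers do. -/
theorem exists_layered_median (S : Type) [Fintype S] [DecidableEq S] (k : ℕ)
    (hk : Fintype.card S ≤ 2 * k + 1) :
    ∃ T, ∀ hi : ℝ, ∃ F : (S → ℝ) → Unit → ℝ, Layered (2 * (Fintype.card S + 2) + 1) T F ∧
      ∀ (v : S → ℝ) (a b : ℝ) (s : Finset S), 0 ≤ a → a ≤ b → b ≤ hi → k + 1 ≤ s.card →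
        (∀ i ∈ s, v i ∈ Set.Icc a b) → F v () ∈ Set.Icc a b := by
  let L : List (List S) := ((Finset.univ : Finset S).powersetCard (k + 1)).toList.map Finset.toList
  have hL : ∀ l : List S, l ∈ L ↔ ∃ t : Finset S, t.card = k + 1 ∧ t.toList = l := by
    intro l
    simp [L, Finset.mem_powersetCard]
  refine ⟨L.length * (1 + (k + 1)), fun hi => ⟨fun v _ =>
    L.foldl (maxMinRound hi) (Sum.elim v fun _ => 0) (.inr true), ?_, ?_⟩⟩
  · have h1 : Layered (2 * (Fintype.card S + 2) + 1) (L.length * (1 + (k + 1)))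
        fun x => L.foldl (maxMinRound hi) x := by
      refine Layered.foldl L fun l hl => ?_
      obtain ⟨t, ht, rfl⟩ := (hL l).1 hl
      have := layered_maxMinRound hi t.toList
      rwa [Finset.length_toList, ht] at this
    exact (h1.precomp (A := fun v : S → ℝ => Sum.elim v fun _ => (0 : ℝ)) (by
      rintro (i | i)
      · exact isAffineFun_apply i
      · exact isAffineFun_const 0)).postcomp fun _ => isAffineFun_apply _
  · intro v a b s ha hab hb hs hv
    obtain ⟨-, h2, h3⟩ := foldl_maxMinRound hi L (Sum.elim v fun _ => 0)
    simp only [Sum.elim_inl, Sum.elim_inr] at h2 h3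
    constructor
    · obtain ⟨t, hts, ht⟩ := Finset.exists_subset_card_eq hs
      refine le_trans ?_ (h2 t.toList ((hL _).2 ⟨t, ht, rfl⟩))
      exact le_foldl_min _ (hab.trans hb) fun i hi => (hv i (hts (Finset.mem_toList.1 hi))).1
    · refine h3 b (ha.trans hab) fun l hl => foldl_min_le _ (.inr ?_)
      obtain ⟨t, ht, rfl⟩ := (hL l).1 hl
      -- two sets of more than half of the indices meet
      have hne : (s ∩ t).Nonempty := by
        rw [← Finset.card_pos]
        have h4 := Finset.card_union_add_card_inter s t
        have h5 := Finset.card_le_univ (s ∪ t)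
        omega
      obtain ⟨i, hi⟩ := hne
      rw [Finset.mem_inter] at hi
      exact ⟨i, Finset.mem_toList.2 hi.2, (hv i hi.1).2⟩

end Median

/-! ### Integer codes of multisets of grid cells -/

theorem eq_and_eq_of_mul_add_eq {B a a' q q' : ℕ} (hq : q < B) (hq' : q' < B)
    (h : B * a + q = B * a' + q') : a = a' ∧ q = q' := by
  have h1 := congrArg (· / B) h
  have h2 := congrArg (· % B) h
  have hB : 0 < B := by omega
  simp only [Nat.mul_add_div hB, Nat.div_eq_of_lt hq, Nat.div_eq_of_lt hq', add_zero] at h1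
  simp only [Nat.mul_add_mod, Nat.mod_eq_of_lt hq, Nat.mod_eq_of_lt hq'] at h2
  exact ⟨h1, h2⟩

theorem sum_pow_mul_inj {B r : ℕ} {s s' : ℕ → ℕ} (hs : ∀ i < r, s i < B) (hs' : ∀ i < r, s' i < B)
    (h : ∑ i ∈ Finset.range r, B ^ i * s i = ∑ i ∈ Finset.range r, B ^ i * s' i) :
    ∀ i < r, s i = s' i := by
  induction r generalizing s s' with
  | zero => intro i hi; omega
  | succ r ih =>
    simp only [Finset.sum_range_succ', pow_zero, one_mul, pow_succ', mul_assoc,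
      ← Finset.mul_sum] at h
    obtain ⟨h1, h2⟩ := eq_and_eq_of_mul_add_eq (hs 0 (by omega)) (hs' 0 (by omega)) h
    have h3 := ih (fun i hi => hs (i + 1) (by omega)) (fun i hi => hs' (i + 1) (by omega)) h1
    rintro (_ | i) hi
    · exact h2
    · exact h3 i (by omega)

theorem sum_pow_mul_lt {B r : ℕ} {s : ℕ → ℕ} (hs : ∀ i < r, s i < B) :
    ∑ i ∈ Finset.range r, B ^ i * s i < B ^ r := by
  induction r with
  | zero => simp
  | succ r ih =>
    rw [Finset.sum_range_succ, pow_succ]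
    have h1 := ih fun i hi => hs i (by omega)
    have h2 : B ^ r * (s r + 1) ≤ B ^ r * B := Nat.mul_le_mul_left _ (hs r (by omega))
    rw [mul_add] at h2
    omega

/-- A multiset of `n` natural numbers is determined by its power sums of degree up to `2 * n`:
by interpolation, the number of occurrences of a value is a linear combination of them. -/
theorem exists_perm_of_sum_pow_eq {n : ℕ} (a b : Fin n → ℕ)
    (h : ∀ k ≤ 2 * n, ∑ j, a j ^ k = ∑ j, b j ^ k) : ∃ σ : Equiv.Perm (Fin n), ∀ j, b (σ j) = a j := by
  classical
  have key : ∀ c, Fintype.card {j // a j = c} = Fintype.card {j // b j = c} := by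
    intro c
    let V : Finset ℕ := Finset.univ.image a ∪ Finset.univ.image b
    have hV : V.card ≤ 2 * n := by
      refine (Finset.card_union_le _ _).trans ?_
      have h1 := Finset.card_image_le (s := (Finset.univ : Finset (Fin n))) (f := a)
      have h2 := Finset.card_image_le (s := (Finset.univ : Finset (Fin n))) (f := b)
      rw [Finset.card_univ, Fintype.card_fin] at h1 h2
      omega
    have haV : ∀ j, a j ∈ V := fun j => Finset.mem_union_left _ (Finset.mem_image_of_mem _ (by simp))
    have hbV : ∀ j, b j ∈ V := fun j => Finset.mem_union_right _ (Finset.mem_image_of_mem _ (by simp))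
    by_cases hc : c ∈ V
    · let P : Polynomial ℚ := Lagrange.basis V (fun i : ℕ => (i : ℚ)) c
      have hinj : Set.InjOn (fun i : ℕ => (i : ℚ)) V := fun x _ y _ hxy => Nat.cast_injective hxy
      have hP : ∀ x ∈ V, P.eval (x : ℚ) = if x = c then 1 else 0 := by
        intro x hx
        split_ifs with hxc
        · subst hxc; exact Lagrange.eval_basis_self hinj hx
        · exact Lagrange.eval_basis_of_ne (fun h => hxc h.symm) hx
      have hdeg : P.natDegree < 2 * n + 1 := by
        have := Lagrange.natDegree_basis hinj hc
        simp only [P]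
        omega
      have hsum : ∀ f : Fin n → ℕ, ∑ j, P.eval (f j : ℚ) =
          ∑ k ∈ Finset.range (2 * n + 1), P.coeff k * ((∑ j, f j ^ k : ℕ) : ℚ) := by
        intro f
        simp only [Polynomial.eval_eq_sum_range' hdeg]
        rw [Finset.sum_comm]
        simp [Finset.mul_sum]
      have heq : ∑ j, P.eval (a j : ℚ) = ∑ j, P.eval (b j : ℚ) := by
        rw [hsum, hsum]
        refine Finset.sum_congr rfl fun k hk => ?_
        rw [h k (by simpa [Nat.lt_succ_iff] using hk)]
      simp only [hP _ (haV _), hP _ (hbV _), Finset.sum_boole] at heq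
      rw [Fintype.card_subtype, Fintype.card_subtype]
      exact_mod_cast heq
    · have h1 : IsEmpty {j // a j = c} := ⟨fun j => hc (j.2 ▸ haV j.1)⟩
      have h2 : IsEmpty {j // b j = c} := ⟨fun j => hc (j.2 ▸ hbV j.1)⟩
      rw [Fintype.card_eq_zero, Fintype.card_eq_zero]
  exact ⟨Equiv.ofFiberEquiv fun c => Fintype.equivOfCardEq (key c),
    fun j => Equiv.ofFiberEquiv_map _ j⟩

/-- The integer with base `2 ^ L` digits `q i`, for `i` in the list `l`, after the leading part
`a`. -/
def packDigits {ι : Type} (L : ℕ) (q : ι → ℕ) (a : ℕ) (l : List ι) : ℕ :=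
  l.foldl (fun a i => 2 ^ L * a + q i) a

theorem packDigits_lt {ι : Type} {L : ℕ} {q : ι → ℕ} (l : List ι) (hq : ∀ i ∈ l, q i < 2 ^ L)
    (a : ℕ) : packDigits L q a l < (a + 1) * 2 ^ (L * l.length) := by
  induction l generalizing a with
  | nil => simp [packDigits]
  | cons i l ih =>
    have h1 := ih (fun j hj => hq j (List.mem_cons_of_mem _ hj)) (2 ^ L * a + q i)
    have h2 := hq i List.mem_cons_self
    calc _ < (2 ^ L * a + q i + 1) * 2 ^ (L * l.length) := h1
      _ ≤ (2 ^ L * (a + 1)) * 2 ^ (L * l.length) := Nat.mul_le_mul_right _ (by rw [mul_add]; omega)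
      _ = _ := by rw [List.length_cons, mul_add_one L, pow_add]; ring

theorem packDigits_inj {ι : Type} {L : ℕ} {q q' : ι → ℕ} (l : List ι) (hq : ∀ i ∈ l, q i < 2 ^ L)
    (hq' : ∀ i ∈ l, q' i < 2 ^ L) {a a' : ℕ} (h : packDigits L q a l = packDigits L q' a' l) :
    a = a' ∧ ∀ i ∈ l, q i = q' i := by
  induction l generalizing a a' with
  | nil => simpa [packDigits] using h
  | cons i l ih =>
    obtain ⟨h1, h2⟩ := ih (fun j hj => hq j (List.mem_cons_of_mem _ hj))
      (fun j hj => hq' j (List.mem_cons_of_mem _ hj)) h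
    obtain ⟨h3, h4⟩ := eq_and_eq_of_mul_add_eq (hq i List.mem_cons_self)
      (hq' i List.mem_cons_self) h1
    refine ⟨h3, fun j hj => ?_⟩
    rcases List.mem_cons.1 hj with rfl | hj
    · exact h4
    · exact h2 j hj

/-- `∑_{k < r} B ^ k * a ^ (k + 1)`, evaluated by Horner's rule. -/
def powerCode (B a : ℕ) : ℕ → ℕ
  | 0 => 0
  | r + 1 => a * (B * powerCode B a r + 1)

theorem powerCode_eq_sum (B a r : ℕ) :
    powerCode B a r = ∑ k ∈ Finset.range r, B ^ k * a ^ (k + 1) := by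
  induction r with
  | zero => rfl
  | succ r ih =>
    rw [powerCode, ih, Finset.sum_range_succ', mul_add, Finset.mul_sum, Finset.mul_sum]
    congr 1
    · refine Finset.sum_congr rfl fun k _ => ?_
      rw [pow_succ, pow_succ a (k + 1)]; ring
    · simp

theorem powerCode_mono {B a a' r r' : ℕ} (ha : a ≤ a') (hr : r ≤ r') :
    powerCode B a r ≤ powerCode B a' r' := by
  rw [powerCode_eq_sum, powerCode_eq_sum]
  calc _ ≤ ∑ k ∈ Finset.range r, B ^ k * a' ^ (k + 1) := by gcongr
    _ ≤ _ := Finset.sum_le_sum_of_subset (Finset.range_mono hr)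

/-- The number of bits of a digit that can hold every power sum of degree at most `2 * n` of `n`
integers of `P` bits. -/
def powerBits (n P : ℕ) : ℕ := n + P * (2 * n)

/-- The code of a tuple of `n` integers of `P` bits: its digits are the power sums. -/
def tupleCode {n : ℕ} (P : ℕ) (a : Fin n → ℕ) : ℕ :=
  ∑ j, powerCode (2 ^ powerBits n P) (a j) (2 * n)

theorem tupleCode_eq {n : ℕ} (P : ℕ) (a : Fin n → ℕ) :
    tupleCode P a =
      ∑ k ∈ Finset.range (2 * n), (2 ^ powerBits n P) ^ k * ∑ j, a j ^ (k + 1) := by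
  simp only [tupleCode, powerCode_eq_sum]
  rw [Finset.sum_comm]
  simp [Finset.mul_sum]

theorem sum_pow_lt {n P : ℕ} {a : Fin n → ℕ} (ha : ∀ j, a j < 2 ^ P) (k : ℕ) (hk : k < 2 * n) :
    ∑ j, a j ^ (k + 1) < 2 ^ powerBits n P := by
  calc ∑ j, a j ^ (k + 1) ≤ ∑ _j : Fin n, 2 ^ (P * (2 * n)) := by
        refine Finset.sum_le_sum fun j _ => ?_
        calc a j ^ (k + 1) ≤ (2 ^ P) ^ (k + 1) := Nat.pow_le_pow_left (ha j).le _
          _ = 2 ^ (P * (k + 1)) := (pow_mul _ _ _).symm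
          _ ≤ _ := Nat.pow_le_pow_right two_pos (Nat.mul_le_mul_left _ hk)
    _ = n * 2 ^ (P * (2 * n)) := by simp
    _ < 2 ^ n * 2 ^ (P * (2 * n)) := Nat.mul_lt_mul_of_pos_right Nat.lt_two_pow_self (by positivity)
    _ = _ := by rw [powerBits, pow_add]

theorem tupleCode_lt {n P : ℕ} {a : Fin n → ℕ} (ha : ∀ j, a j < 2 ^ P) :
    tupleCode P a < 2 ^ (powerBits n P * (2 * n)) := by
  rw [tupleCode_eq, pow_mul]
  exact sum_pow_mul_lt fun k hk => sum_pow_lt ha k hk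

theorem exists_perm_of_tupleCode_eq {n P : ℕ} {a b : Fin n → ℕ} (ha : ∀ j, a j < 2 ^ P)
    (hb : ∀ j, b j < 2 ^ P) (h : tupleCode P a = tupleCode P b) :
    ∃ σ : Equiv.Perm (Fin n), ∀ j, b (σ j) = a j := by
  rw [tupleCode_eq, tupleCode_eq] at h
  have := sum_pow_mul_inj (fun k hk => sum_pow_lt ha k hk) (fun k hk => sum_pow_lt hb k hk) h
  refine exists_perm_of_sum_pow_eq a b fun k hk => ?_
  cases k with
  | zero => simp
  | succ k => exact this k hk

/-! ### The network that encodes a point -/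

/-- The index of the cell of `y ∈ [-1, 1]` in the grid of mesh `8 / 2 ^ L`, shifted by the
fraction `τ` of the mesh. -/
noncomputable def gridIndex (L : ℕ) (τ y : ℝ) : ℕ := ⌊2 ^ L * ((y + 2) / 8) + τ⌋₊

theorem gridIndex_lt {L : ℕ} (hL : 1 ≤ L) {τ y : ℝ} (hτ : τ < 1) (hy : y ≤ 1) :
    gridIndex L τ y < 2 ^ L := by
  have h2 : (2 : ℝ) ≤ 2 ^ L := by simpa using pow_le_pow_right₀ one_le_two hL
  rw [gridIndex]
  refine Nat.floor_lt' (by positivity) |>.2 ?_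
  push_cast
  nlinarith

section Encoder

variable {d : ℕ}

/-- Loads the rescaled coordinate `i` into the register `inr 0` and appends its `L` leading binary
digits to the integer in the register `inr 1`. -/
noncomputable def loadRound (s : ℝ) (L : ℕ) (τ : ℝ) (x : Fin d ⊕ Fin 4 → ℝ) (i : Fin d) :
    Fin d ⊕ Fin 4 → ℝ :=
  (bitStep s (.inr 0) (.inr 1) (.inr 2))^[L]
    (Function.update x (.inr 0) ((x (.inl i) + 2) / 8 + τ / 2 ^ L))

/-- One step of Horner's rule for `powerCode`: the register `inr 1` is multiplied by `B`, increased
by `1`, and multiplied by the `P`-bit integer in the register `inr 3`. -/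
noncomputable def powerRound (s : ℝ) (P : ℕ) (B : ℝ) (x : Fin d ⊕ Fin 4 → ℝ) :
    Fin d ⊕ Fin 4 → ℝ :=
  (bitStep s (.inr 0) (.inr 1) (.inr 2))^[P]
    (Sum.elim (fun i => x (.inl i))
      ![x (.inr 3) / 2 ^ P, 0, B * x (.inr 1) + 1, x (.inr 3)])

theorem layered_loadRound (s : ℝ) (L : ℕ) (τ : ℝ) (i : Fin d) :
    Layered (2 * (d + 4) + 3) L fun x => loadRound s L τ x i := by
  have h := (layered_bitStep (ι := Fin d ⊕ Fin 4) (H := 2 * (d + 4) + 3) (by simp) s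
    (.inr 0) (.inr 1) (.inr 2)).iterate L
  rw [mul_one] at h
  refine h.precomp fun k => isAffineFun_iff.2 fun c x y => ?_
  simp only [Function.update_apply, Pi.add_apply, Pi.smul_apply, Pi.zero_apply, smul_eq_mul]
  split_ifs <;> ring

theorem layered_powerRound (s : ℝ) (P : ℕ) (B : ℝ) :
    Layered (2 * (d + 4) + 3) P (powerRound (d := d) s P B) := by
  have h := (layered_bitStep (ι := Fin d ⊕ Fin 4) (H := 2 * (d + 4) + 3) (by simp) s
    (.inr 0) (.inr 1) (.inr 2)).iterate P
  rw [mul_one] at h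
  refine h.precomp fun k => isAffineFun_iff.2 fun c x y => ?_
  rcases k with i | k
  · simp
  · fin_cases k <;> simp <;> ring

theorem foldl_loadRound {s : ℝ} {L : ℕ} {τ : ℝ} (hL : 1 ≤ L) (hτ0 : 0 ≤ τ) (hτ1 : τ < 1)
    {y : Fin d → ℝ} (hy : ∀ i, y i ∈ Set.Icc (-1) 1) (hs0 : 0 ≤ s)
    (hs : ∀ i, 2 ^ L ≤ s * (1 - Int.fract (2 ^ L * ((y i + 2) / 8) + τ))) (l : List (Fin d)) :
    ∀ (a : ℕ) (x : Fin d ⊕ Fin 4 → ℝ), (∀ i, x (.inl i) = y i) → x (.inr 1) = a →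
      x (.inr 2) = 1 →
      l.foldl (loadRound s L τ) x (.inr 1) = packDigits L (fun i => gridIndex L τ (y i)) a l := by
  induction l with
  | nil => intro a x _ ha _; simpa [packDigits] using ha
  | cons i l ih =>
    intro a x hx ha hz
    have hpos : 0 ≤ 2 ^ L * ((y i + 2) / 8) + τ := by
      have := (hy i).1
      have : 0 ≤ (y i + 2) / 8 := by linarith
      positivity
    have hround : loadRound s L τ x i = Function.update (Function.update x (.inr 0)
        (Int.fract (2 ^ L * ((y i + 2) / 8) + τ))) (.inr 1)
        (2 ^ L * a + gridIndex L τ (y i)) := by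
      rw [loadRound, bitStep_iterate hs0 (by simp) (by simp) (by simp) L (gridIndex L τ (y i))
        (Int.fract (2 ^ L * ((y i + 2) / 8) + τ)) _ (gridIndex_lt hL hτ1 (hy i).2) ?_
        (Int.fract_nonneg _) (by simp [hz]) (hs i) (by simpa [hz] using hs i)]
      · simp [ha, hz]
      · rw [Function.update_self, gridIndex, natCast_floor_eq_intCast_floor hpos,
          Int.floor_add_fract, hx]
        field_simp
    rw [List.foldl_cons, hround, ih (2 ^ L * a + gridIndex L τ (y i))]
    · rfl
    · simpa using hx
    · simp
    · simpa using hz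

theorem powerRound_iterate {s : ℝ} {P B a r : ℕ} (ha : a < 2 ^ P)
    (hs : 2 ^ P * ((B * powerCode B (2 ^ P) r + 1 : ℕ) : ℝ) ≤ s) :
    ∀ k ≤ r, ∀ x : Fin d ⊕ Fin 4 → ℝ, x (.inr 1) = 0 → x (.inr 3) = a →
      (powerRound s P B)^[k] x (.inr 1) = powerCode B a k ∧
        (powerRound s P B)^[k] x (.inr 3) = a := by
  intro k
  induction k with
  | zero => intro _ x h1 h3; simp [h1, h3, powerCode]
  | succ k ih =>
    intro hk x h1 h3
    obtain ⟨e1, e3⟩ := ih (by omega) x h1 h3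
    rw [Function.iterate_succ_apply']
    set x' := (powerRound s P B)^[k] x
    have hz : (B : ℝ) * powerCode B a k + 1 = ((B * powerCode B a k + 1 : ℕ) : ℝ) := by push_cast; rfl
    have hbound : 2 ^ P * ((B * powerCode B a k + 1 : ℕ) : ℝ) ≤ s := by
      refine le_trans ?_ hs
      gcongr
      exact powerCode_mono ha.le (by omega)
    have h1P : (2 : ℝ) ^ P ≤ s := by
      refine le_trans ?_ hbound
      refine le_mul_of_one_le_right (by positivity) ?_
      push_cast
      have : (0 : ℝ) ≤ B * powerCode B a k := by positivity
      linarith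
    rw [powerRound, bitStep_iterate (le_trans (by positivity) h1P) (by simp) (by simp) (by simp) P a
      0 _ ha (by simp [e3]) le_rfl (by simp [e1]; positivity) (by simpa using h1P)
      (by simpa [e1] using hbound)]
    constructor
    · rw [Function.update_self]
      simp only [Sum.elim_inr, Matrix.cons_val, e1, powerCode]
      push_cast
      ring
    · rw [Function.update_of_ne (by simp), Function.update_of_ne (by simp)]
      simpa only [Sum.elim_inr, Matrix.cons_val] using e3

/-- A network of bounded width and depth `O (L)` that computes, for a point with entries in
`[-1, 1]` none of which is slightly below the upper end of its cell in the grid shifted by `τ`, the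
`powerCode` of the packed cell indices of the point. -/
theorem exists_layered_encoder (d n L : ℕ) {m : ℕ} (hm : 0 < m) (hL : 1 ≤ L) {τ : ℝ} (hτ0 : 0 ≤ τ) (hτ1 : τ < 1) :
    ∃ F : (Fin d → ℝ) → Unit → ℝ, Layered (2 * (d + 4) + 3) (2 * n * (L * d) + d * L) F ∧
      ∀ y : Fin d → ℝ, (∀ i, y i ∈ Set.Icc (-1) 1) →
        (∀ i, Int.fract (2 ^ L * ((y i + 2) / 8) + τ) ≤ 1 - 1 / m) →
        F y () = powerCode (2 ^ powerBits n (L * d))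
          (packDigits L (fun i => gridIndex L τ (y i)) 0 (List.finRange d)) (2 * n) := by
  set P := L * d
  set B := 2 ^ powerBits n P
  -- steep enough for the margin `1 / m` of the coordinates and for all factors of the products
  let s : ℝ := m * 2 ^ L + 2 ^ P * ((B * powerCode B (2 ^ P) (2 * n) + 1 : ℕ) : ℝ)
  refine ⟨fun y _ => (powerRound s P B)^[2 * n]
    ((fun x : Fin d ⊕ Fin 4 → ℝ => Sum.elim (fun i => x (.inl i)) ![0, 0, 0, x (.inr 1)])
      ((List.finRange d).foldl (loadRound s L τ) (Sum.elim y ![0, 0, 1, 0]))) (.inr 1), ?_, ?_⟩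
  · have h1 := (Layered.foldl (List.finRange d)
      fun i _ => layered_loadRound (d := d) s L τ i).precomp
        (A := fun y : Fin d → ℝ => Sum.elim y ![0, 0, 1, 0]) (by
          rintro (i | k)
          · exact isAffineFun_apply i
          · exact isAffineFun_const _)
    have h2 := (((layered_powerRound (d := d) s P B).iterate (2 * n)).precomp
      (A := fun x : Fin d ⊕ Fin 4 → ℝ =>
        Sum.elim (fun i => x (.inl i)) ![0, 0, 0, x (.inr 1)]) (by
          rintro (i | k)
          · exact isAffineFun_apply (ι := Fin d ⊕ Fin 4) (.inl i)
          · fin_cases k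
            · exact isAffineFun_const _
            · exact isAffineFun_const _
            · exact isAffineFun_const _
            · exact isAffineFun_apply (ι := Fin d ⊕ Fin 4) (.inr 1))).comp h1
    rw [List.length_finRange] at h2
    exact h2.postcomp (μ := Unit) (A := fun x _ => x (.inr 1)) fun _ => isAffineFun_apply _
  · intro y hy hgood
    have hs0 : 0 ≤ s := by positivity
    have hload := foldl_loadRound (s := s) hL hτ0 hτ1 hy hs0 (by
      intro i
      have h1 := hgood i
      have hm' : (0 : ℝ) < m := by exact_mod_cast hm
      calc (2 : ℝ) ^ L = m * 2 ^ L * (1 / m) := by field_simp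
        _ ≤ s * (1 / m) := by
            gcongr
            simp only [s]
            have : (0 : ℝ) ≤ 2 ^ P * ((B * powerCode B (2 ^ P) (2 * n) + 1 : ℕ) : ℝ) := by positivity
            linarith
        _ ≤ _ := by gcongr; linarith) (List.finRange d) 0
      (Sum.elim y ![0, 0, 1, 0]) (by simp) (by simp) (by simp)
    refine (powerRound_iterate (r := 2 * n) ?_ ?_ (2 * n) le_rfl _ (by simp) ?_).1
    · have := packDigits_lt (L := L) (q := fun i => gridIndex L τ (y i)) (List.finRange d)
        (fun i _ => gridIndex_lt hL hτ1 (hy i).2) 0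
      simpa using this
    · simp only [s]
      have : (0 : ℝ) ≤ m * 2 ^ L := by positivity
      linarith
    · simpa using hload

end Encoder

/-! ### Nets of orthogonal systems -/

theorem exists_finset_representatives {X ι : Type} [Fintype ι] (s : Set X) (φ : X → ι) :
    ∃ T : Finset X, (∀ c ∈ T, c ∈ s) ∧ T.card ≤ Fintype.card ι ∧ ∀ x ∈ s, ∃ c ∈ T, φ c = φ x := by
  classical
  let g : {i // ∃ x ∈ s, φ x = i} → X := fun i => i.2.choose
  have hg : ∀ i, g i ∈ s ∧ φ (g i) = i := fun i => i.2.choose_spec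
  refine ⟨Finset.univ.image g, ?_, ?_, fun x hx => ?_⟩
  · intro c hc
    obtain ⟨i, -, rfl⟩ := Finset.mem_image.1 hc
    exact (hg i).1
  · exact Finset.card_image_le.trans (by rw [Finset.card_univ]; exact Fintype.card_subtype_le _)
  · exact ⟨g ⟨φ x, x, hx, rfl⟩, Finset.mem_image_of_mem _ (Finset.mem_univ _), (hg _).2⟩

/-- The unit sphere of a `(q + 1)`-dimensional space has a `1 / Q`-net of size `O (Q ^ q)`: a unit
vector is determined by the position and the sign of a large coordinate, together with the other
`q` coordinates. -/
theorem exists_sphere_net (q : ℕ) : ∃ C : ℕ, ∀ (E : Type) [NormedAddCommGroup E]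
    [InnerProductSpace ℝ E] [FiniteDimensional ℝ E], Module.finrank ℝ E = q + 1 → ∀ Q : ℕ, 0 < Q →
    ∃ T : Finset E, (∀ c ∈ T, ‖c‖ = 1) ∧ T.card ≤ C * Q ^ q ∧
      ∀ v : E, ‖v‖ = 1 → ∃ c ∈ T, ‖v - c‖ ≤ 1 / Q := by
  classical
  refine ⟨(q + 1) * 2 * (3 * (q + 1) ^ 2) ^ q, fun E _ _ _ hE Q hQ => ?_⟩
  let b : OrthonormalBasis (Fin (q + 1)) ℝ E := (stdOrthonormalBasis ℝ E).reindex (finCongr hE)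
  let x : E → Fin (q + 1) → ℝ := fun v j => b.repr v j
  have hsum : ∀ v, ‖v‖ = 1 → ∑ j, x v j ^ 2 = 1 := by
    intro v hv
    have := EuclideanSpace.norm_sq_eq (b.repr v)
    rw [b.repr.norm_map, hv] at this
    simpa [x] using this.symm
  have habs : ∀ v, ‖v‖ = 1 → ∀ j, |x v j| ≤ 1 := by
    intro v hv j
    rw [← sq_le_one_iff_abs_le_one, ← hsum v hv]
    exact Finset.single_le_sum (f := fun j => x v j ^ 2) (fun _ _ => sq_nonneg _)
      (Finset.mem_univ j)
  have hbig : ∀ v, ‖v‖ = 1 → ∃ i, 1 ≤ (q + 1) * |x v i| := by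
    intro v hv
    by_contra! hc
    have h1 : ∀ i, x v i ^ 2 ≤ |x v i| := by
      intro i
      rw [← sq_abs, sq]
      exact mul_le_of_le_one_left (abs_nonneg _) (habs v hv i)
    have h2 : (q + 1 : ℝ) * ∑ j, x v j ^ 2 < ∑ _j : Fin (q + 1), 1 := by
      rw [Finset.mul_sum]
      refine Finset.sum_lt_sum_of_nonempty Finset.univ_nonempty fun j _ => ?_
      exact lt_of_le_of_lt (by gcongr; exact h1 j) (hc j)
    rw [hsum v hv] at h2
    simp at h2
  choose! i hi using hbig
  set N := (q + 1) ^ 2 * Q with hN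
  have hNpos : 0 < N := by positivity
  have hN1 : (0 : ℝ) < N := by exact_mod_cast hNpos
  -- `Fin.ofNat` reduces modulo `2 * N + 1`, which is harmless for the coordinates of unit vectors
  let φ : E → Fin (q + 1) × Bool × (Fin q → Fin (2 * N + 1)) := fun v =>
    (i v, decide (0 ≤ x v (i v)),
      fun k => Fin.ofNat (2 * N + 1) (⌊N * x v ((i v).succAbove k)⌋ + N).toNat)
  obtain ⟨T, hT1, hT2, hT3⟩ := exists_finset_representatives {v : E | ‖v‖ = 1} φ
  refine ⟨T, hT1, hT2.trans ?_, fun v hv => ?_⟩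
  · simp only [Fintype.card_prod, Fintype.card_fin, Fintype.card_bool, Fintype.card_fun]
    calc (q + 1) * (2 * (2 * N + 1) ^ q) ≤ (q + 1) * (2 * (3 * N) ^ q) := by gcongr; omega
      _ = _ := by rw [hN, ← mul_assoc 3, mul_pow _ Q]; ring
  · obtain ⟨c, hcT, hφ⟩ := hT3 v hv
    have hc : ‖c‖ = 1 := hT1 c hcT
    simp only [φ, Prod.mk.injEq] at hφ
    obtain ⟨e1, e2, e3⟩ := hφ
    rw [e1] at e2 e3
    set i₀ := i v with hi₀
    have hother : ∀ k, |x v (i₀.succAbove k) - x c (i₀.succAbove k)| ≤ 1 / N := by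
      intro k
      have h := congrArg Fin.val (congrFun e3 k)
      have hr : ∀ u, ‖u‖ = 1 → 0 ≤ ⌊N * x u (i₀.succAbove k)⌋ + N ∧
          ⌊N * x u (i₀.succAbove k)⌋ + N ≤ 2 * N := by
        intro u hu
        obtain ⟨ha, hb⟩ := abs_le.1 (habs u hu (i₀.succAbove k))
        constructor
        · have : (-N : ℤ) ≤ ⌊N * x u (i₀.succAbove k)⌋ := by
            rw [Int.le_floor]; push_cast; nlinarith
          omega
        · have : ⌊N * x u (i₀.succAbove k)⌋ ≤ N := by
            refine Int.cast_le (R := ℝ).1 ((Int.floor_le _).trans ?_)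
            push_cast; nlinarith
          omega
      obtain ⟨hv1, hv2⟩ := hr v hv
      obtain ⟨hc1, hc2⟩ := hr c hc
      simp only [Fin.ofNat] at h
      rw [Nat.mod_eq_of_lt (by omega), Nat.mod_eq_of_lt (by omega)] at h
      have hfl : ⌊N * x v (i₀.succAbove k)⌋ = ⌊N * x c (i₀.succAbove k)⌋ := by omega
      have := (Int.abs_sub_lt_one_of_floor_eq_floor hfl).le
      rw [← mul_sub, abs_mul, abs_of_pos hN1] at this
      rw [le_div_iff₀ hN1]
      linarith
    have hcoord : |x v i₀ - x c i₀| ≤ q * (q + 1) / N := by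
      -- the large coordinate is recovered from the others by Pythagoras
      have h1 : (x v i₀ - x c i₀) * (x v i₀ + x c i₀) = ∑ k, (x c (i₀.succAbove k) -
          x v (i₀.succAbove k)) * (x c (i₀.succAbove k) + x v (i₀.succAbove k)) := by
        have h2 := hsum v hv
        have h3 := hsum c hc
        rw [Fin.sum_univ_succAbove _ i₀] at h2 h3
        have h4 : ∀ a b : ℝ, (a - b) * (a + b) = a ^ 2 - b ^ 2 := fun a b => by ring
        simp only [h4, Finset.sum_sub_distrib]
        linarith
      have h2 : |x v i₀ - x c i₀| * |x v i₀ + x c i₀| ≤ q * (2 / N) := by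
        rw [← abs_mul, h1]
        refine (Finset.abs_sum_le_sum_abs _ _).trans ?_
        refine (Finset.sum_le_card_nsmul _ _ (2 / N : ℝ) fun k _ => ?_).trans (by simp)
        rw [abs_mul, abs_sub_comm]
        calc _ ≤ (1 / N : ℝ) * 2 := by
              gcongr
              · exact hother k
              · exact (abs_add_le _ _).trans (by
                  linarith [habs v hv (i₀.succAbove k), habs c hc (i₀.succAbove k)])
          _ = _ := by ring
      have h3 : 2 ≤ (q + 1) * |x v i₀ + x c i₀| := by
        have hv' := hi v hv
        have hc' := hi c hc
        rw [e1] at hc'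
        rw [← hi₀] at hv'
        have : |x v i₀ + x c i₀| = |x v i₀| + |x c i₀| := by
          by_cases hs : 0 ≤ x v i₀
          · have hs' : 0 ≤ x c i₀ := by simpa [hs] using e2
            rw [abs_of_nonneg hs, abs_of_nonneg hs', abs_of_nonneg (by linarith)]
          · have hs' : ¬ 0 ≤ x c i₀ := by simpa [hs] using e2
            push Not at hs hs'
            rw [abs_of_neg hs, abs_of_neg hs', abs_of_neg (by linarith)]
            ring
        rw [this]
        linarith
      have h4 : |x v i₀ - x c i₀| * 2 ≤ q * (2 / N) * (q + 1) := by
        calc _ ≤ |x v i₀ - x c i₀| * ((q + 1) * |x v i₀ + x c i₀|) := by gcongr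
          _ = |x v i₀ - x c i₀| * |x v i₀ + x c i₀| * (q + 1) := by ring
          _ ≤ _ := by gcongr
      calc |x v i₀ - x c i₀| ≤ q * (2 / N) * (q + 1) / 2 := by linarith
        _ = _ := by ring
    refine ⟨c, hcT, ?_⟩
    have hnorm : ‖v - c‖ ≤ ∑ j, |x v j - x c j| := by
      rw [← b.sum_repr (v - c)]
      refine (norm_sum_le _ _).trans (Finset.sum_le_sum fun j _ => ?_)
      rw [norm_smul, b.norm_eq_one, mul_one, map_sub]
      rfl
    rw [Fin.sum_univ_succAbove _ i₀] at hnorm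
    have h5 : ∑ k, |x v (i₀.succAbove k) - x c (i₀.succAbove k)| ≤ q * (1 / N) :=
      (Finset.sum_le_card_nsmul _ _ (1 / N : ℝ) fun k _ => hother k).trans (by simp)
    calc ‖v - c‖ ≤ q * (q + 1) / N + q * (1 / N) := by linarith
      _ = q * (q + 2) / N := by ring
      _ ≤ (q + 1) ^ 2 / N := by gcongr; nlinarith
      _ = 1 / Q := by
          rw [hN]
          push_cast
          field_simp

/-- The linear map `u ↦ u - (⟪u, c⟫ / (1 + ⟪v, c⟫)) (v + c)` restricts to an isometry from the
orthogonal complement of `v` to the one of `c`, if `v` and `c` are unit vectors. It is close to the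
identity if `v` and `c` are close to each other. -/
theorem exists_rotation {E : Type} [NormedAddCommGroup E] [InnerProductSpace ℝ E] {v c : E}
    (hv : ‖v‖ = 1) (hc : ‖c‖ = 1) (hvc : ‖v - c‖ ≤ 1) :
    ∃ R : E → E, (∀ u, inner ℝ v u = 0 → inner ℝ c (R u) = 0) ∧
      (∀ u w, inner ℝ v u = 0 → inner ℝ v w = 0 → inner ℝ (R u) (R w) = inner ℝ u w) ∧
      ∀ u, inner ℝ v u = 0 → ‖u - R u‖ ≤ 2 * ‖u‖ * ‖v - c‖ := by
  have hvv : inner ℝ v v = (1 : ℝ) := by rw [real_inner_self_eq_norm_sq, hv]; norm_num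
  have hcc : inner ℝ c c = (1 : ℝ) := by rw [real_inner_self_eq_norm_sq, hc]; norm_num
  have hhalf : (1 : ℝ) / 2 ≤ inner ℝ v c := by
    have h := norm_sub_sq_real v c
    rw [hv, hc] at h
    have : ‖v - c‖ ^ 2 ≤ 1 := by rw [sq_le_one_iff_abs_le_one, abs_of_nonneg (norm_nonneg _)]; exact hvc
    linarith
  have hpos : (0 : ℝ) < 1 + inner ℝ v c := by linarith
  let a : E → ℝ := fun u => inner ℝ c u / (1 + inner ℝ v c)
  have ha : ∀ u, inner ℝ c u = a u * (1 + inner ℝ v c) := fun u => by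
    simp only [a]; field_simp
  refine ⟨fun u => u - a u • (v + c), fun u hu => ?_, fun u w hu hw => ?_, fun u hu => ?_⟩
  · rw [inner_sub_right, inner_smul_right, inner_add_right, hcc, real_inner_comm v c,
      ha u]
    ring
  · simp only [inner_sub_left, inner_sub_right, inner_smul_left, inner_smul_right, inner_add_left,
      inner_add_right, hvv, hcc, hw, RCLike.conj_to_real]
    rw [real_inner_comm v u, hu, real_inner_comm c u, ha u, ha w, real_inner_comm v c]
    ring
  · rw [sub_sub_cancel, norm_smul]
    have h1 : ‖v + c‖ ≤ 2 := (norm_add_le _ _).trans (by rw [hv, hc]; norm_num)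
    have h2 : ‖a u‖ ≤ ‖u‖ * ‖v - c‖ := by
      have h3 : inner ℝ c u = -(inner ℝ (v - c) u : ℝ) := by rw [inner_sub_left, hu]; ring
      simp only [a]
      rw [norm_div, Real.norm_eq_abs (1 + _), abs_of_pos hpos]
      refine (div_le_self (norm_nonneg _) (by linarith)).trans ?_
      rw [h3, norm_neg, mul_comm]
      exact norm_inner_le_norm _ _
    calc ‖a u‖ * ‖v + c‖ ≤ (‖u‖ * ‖v - c‖) * 2 := by gcongr
      _ = _ := by ring

/-- Systems of `d` pairwise orthogonal vectors in the unit ball of a `p`-dimensional space have nets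
of the size that the dimension count predicts: the `i`-th vector is orthogonal to the preceding
ones, hence has `p - i` degrees of freedom. The first vector is a multiple `μ v` of a unit vector
`v` orthogonal to all the others; approximating `v` by `c` and rotating the others into the
orthogonal complement of `c` reduces `d` and `p` by one. -/
theorem exists_orthogonal_net : ∀ d p : ℕ, d ≤ p → ∃ C : ℕ, ∀ (E : Type) [NormedAddCommGroup E]
    [InnerProductSpace ℝ E] [FiniteDimensional ℝ E], Module.finrank ℝ E = p → ∀ Q : ℕ, 0 < Q →
    ∃ T : Finset (Fin d → E), T.card ≤ C * Q ^ (∑ i ∈ Finset.range d, (p - i)) ∧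
      ∀ y : Fin d → E, (∀ i j, i ≠ j → inner ℝ (y i) (y j) = 0) → (∀ i, ‖y i‖ ≤ 1) →
        ∃ c ∈ T, ∀ i, ‖y i - c i‖ ≤ C / Q := by
  classical
  intro d
  induction d with
  | zero =>
    intro p _
    refine ⟨1, fun E _ _ _ _ Q _ => ⟨{0}, by simp, fun y _ _ => ⟨0, by simp, fun i => i.elim0⟩⟩⟩
  | succ d ih =>
    intro p hp
    obtain ⟨q, rfl⟩ : ∃ q, p = q + 1 := ⟨p - 1, by omega⟩
    obtain ⟨C₁, h₁⟩ := exists_sphere_net q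
    obtain ⟨C₂, h₂⟩ := ih q (by omega)
    refine ⟨2 * C₁ * C₂ + C₂ + 2, fun E _ _ _ hE Q hQ => ?_⟩
    have hQ1 : (1 : ℝ) ≤ Q := by exact_mod_cast hQ
    have hQ0 : (0 : ℝ) < Q := by linarith
    obtain ⟨T₁, hT₁, hcard₁, hnet₁⟩ := h₁ E hE Q hQ
    have hcompl : ∀ c : E, ∃ T : Finset (Fin d → E), ‖c‖ = 1 →
        T.card ≤ C₂ * Q ^ (∑ i ∈ Finset.range d, (q - i)) ∧
        ∀ y : Fin d → E, (∀ i, inner ℝ c (y i) = 0) → (∀ i j, i ≠ j → inner ℝ (y i) (y j) = 0) →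
          (∀ i, ‖y i‖ ≤ 1) → ∃ w ∈ T, ∀ i, ‖y i - w i‖ ≤ C₂ / Q := by
      intro c
      by_cases hc : ‖c‖ = 1
      · have hc0 : c ≠ 0 := by rintro rfl; simp at hc
        have : Fact (Module.finrank ℝ E = q + 1) := ⟨hE⟩
        obtain ⟨T, hT, hnet⟩ := h₂ (Submodule.span ℝ {c})ᗮ
          (Submodule.finrank_orthogonal_span_singleton hc0) Q hQ
        refine ⟨T.image fun w i => (w i : E), fun _ => ⟨Finset.card_image_le.trans hT, ?_⟩⟩
        intro y hcy hy hy1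
        obtain ⟨w, hw, h⟩ := hnet (fun i => ⟨y i, Submodule.mem_orthogonal_singleton_iff_inner_right.2
          (hcy i)⟩) (fun i j hij => hy i j hij) fun i => hy1 i
        exact ⟨fun i => w i, Finset.mem_image_of_mem _ hw, h⟩
      · exact ⟨∅, fun h => absurd h hc⟩
    choose T₂ hT₂ using hcompl
    refine ⟨(Finset.range (Q + 1)).biUnion fun k => T₁.biUnion fun c => (T₂ c).image fun w =>
      Fin.cons (((k : ℝ) / Q) • c) w, ?_, ?_⟩
    · have hcard : ∀ k ∈ Finset.range (Q + 1), (T₁.biUnion fun c => (T₂ c).image fun w =>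
          (Fin.cons (((k : ℝ) / Q) • c) w : Fin (d + 1) → E)).card ≤
          (C₁ * Q ^ q) * (C₂ * Q ^ (∑ i ∈ Finset.range d, (q - i))) := fun k _ =>
        (Finset.card_biUnion_le_card_mul _ _ _ fun c hc =>
          Finset.card_image_le.trans (hT₂ c (hT₁ c hc)).1).trans (Nat.mul_le_mul_right _ hcard₁)
      refine (Finset.card_biUnion_le_card_mul _ _ _ hcard).trans ?_
      rw [Finset.card_range, Finset.sum_range_succ']
      simp only [Nat.add_sub_add_right, Nat.sub_zero]
      rw [pow_add]
      calc (Q + 1) * (C₁ * Q ^ q * (C₂ * Q ^ (∑ i ∈ Finset.range d, (q - i))))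
          ≤ (2 * Q) * (C₁ * Q ^ q * (C₂ * Q ^ (∑ i ∈ Finset.range d, (q - i)))) := by
            gcongr; omega
        _ = (2 * C₁ * C₂) * (Q ^ (∑ i ∈ Finset.range d, (q - i)) * Q ^ (q + 1)) := by ring
        _ ≤ _ := by gcongr; omega
    · intro y hy hy1
      -- a unit vector `v` in the direction of `y 0`, orthogonal to the other vectors
      obtain ⟨v, μ, hv, hμ0, hμ1, hyv, hvy⟩ : ∃ (v : E) (μ : ℝ), ‖v‖ = 1 ∧ 0 ≤ μ ∧ μ ≤ 1 ∧
          y 0 = μ • v ∧ ∀ i : Fin d, inner ℝ v (y i.succ) = 0 := by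
        by_cases h0 : y 0 = 0
        · let W := Submodule.span ℝ (Set.range fun i : Fin d => y i.succ)
          have hW : Module.finrank ℝ W ≤ d := by
            have := finrank_range_le_card (R := ℝ) fun i : Fin d => y i.succ
            rwa [Fintype.card_fin] at this
          have hW' := W.finrank_add_finrank_orthogonal
          have : 0 < Module.finrank ℝ Wᗮ := by omega
          have := Module.finrank_pos_iff.1 this
          obtain ⟨u, hu⟩ := exists_ne (0 : Wᗮ)
          have hu0 : ‖(u : E)‖ ≠ 0 := by simpa using hu
          refine ⟨(‖(u : E)‖)⁻¹ • (u : E), 0, ?_, le_rfl, zero_le_one, by simp [h0], fun i => ?_⟩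
          · rw [norm_smul, norm_inv, norm_norm, inv_mul_cancel₀ hu0]
          · rw [inner_smul_left, real_inner_comm,
              (Submodule.mem_orthogonal _ _).1 u.2 _ (Submodule.subset_span ⟨i, rfl⟩), mul_zero]
        · have h0' : ‖y 0‖ ≠ 0 := by simpa using h0
          refine ⟨(‖y 0‖)⁻¹ • y 0, ‖y 0‖, ?_, norm_nonneg _, hy1 0, ?_, fun i => ?_⟩
          · rw [norm_smul, norm_inv, norm_norm, inv_mul_cancel₀ h0']
          · rw [smul_smul, mul_inv_cancel₀ h0', one_smul]
          · rw [inner_smul_left, hy 0 i.succ (Fin.succ_ne_zero i).symm, mul_zero]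
      obtain ⟨c, hcT, hvc⟩ := hnet₁ v hv
      have hc := hT₁ c hcT
      have hvc1 : ‖v - c‖ ≤ 1 := hvc.trans (by rw [div_le_one hQ0]; exact hQ1)
      obtain ⟨R, hR1, hR2, hR3⟩ := exists_rotation hv hc hvc1
      obtain ⟨w, hw, hnear⟩ := (hT₂ c hc).2 (fun i => R (y i.succ)) (fun i => hR1 _ (hvy i))
        (fun i j hij => by
          rw [hR2 _ _ (hvy i) (hvy j)]
          exact hy _ _ fun h => hij (Fin.succ_injective _ h))
        (fun i => by
          have h := hR2 _ _ (hvy i) (hvy i)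
          rw [real_inner_self_eq_norm_sq, real_inner_self_eq_norm_sq] at h
          have := hy1 i.succ
          nlinarith [norm_nonneg (R (y i.succ)), norm_nonneg (y i.succ)])
      have hk : ⌊Q * μ⌋₊ ∈ Finset.range (Q + 1) := by
        rw [Finset.mem_range, Nat.lt_succ_iff]
        refine Nat.floor_le_of_le ?_
        nlinarith
      refine ⟨Fin.cons (((⌊Q * μ⌋₊ : ℝ) / Q) • c) w, ?_, ?_⟩
      · exact Finset.mem_biUnion.2 ⟨_, hk, Finset.mem_biUnion.2 ⟨c, hcT,
          Finset.mem_image_of_mem _ hw⟩⟩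
      · have hC₁ : (0 : ℝ) ≤ C₁ := Nat.cast_nonneg _
        have hC₂ : (0 : ℝ) ≤ C₂ := Nat.cast_nonneg _
        refine Fin.cases ?_ fun i => ?_
        · rw [Fin.cons_zero, hyv]
          have h1 : |μ - (⌊Q * μ⌋₊ : ℝ) / Q| ≤ 1 / Q := by
            have h2 := Nat.floor_le (mul_nonneg hQ0.le hμ0)
            have h3 := Nat.lt_floor_add_one (Q * μ)
            have h4 : μ - (⌊Q * μ⌋₊ : ℝ) / Q = (Q * μ - ⌊Q * μ⌋₊) / Q := by field_simp
            rw [h4, abs_div, abs_of_pos hQ0, abs_of_nonneg (by linarith)]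
            gcongr
            linarith
          have h5 : μ • v - ((⌊Q * μ⌋₊ : ℝ) / Q) • c =
              μ • (v - c) + (μ - (⌊Q * μ⌋₊ : ℝ) / Q) • c := by
            rw [smul_sub, sub_smul]; abel
          rw [h5]
          calc _ ≤ ‖μ • (v - c)‖ + ‖(μ - (⌊Q * μ⌋₊ : ℝ) / Q) • c‖ := norm_add_le _ _
            _ ≤ 1 * (1 / Q) + (1 / Q) * 1 := by
                rw [norm_smul, norm_smul, hc, Real.norm_eq_abs, Real.norm_eq_abs, abs_of_nonneg hμ0]
                gcongr
            _ = 2 / Q := by ring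
            _ ≤ _ := by
                gcongr
                push_cast
                nlinarith
        · rw [Fin.cons_succ]
          have h1 := hR3 _ (hvy i)
          have h2 := hy1 i.succ
          calc ‖y i.succ - w i‖ ≤ ‖y i.succ - R (y i.succ)‖ + ‖R (y i.succ) - w i‖ :=
                norm_sub_le_norm_sub_add_norm_sub _ _ _
            _ ≤ 2 * 1 * (1 / Q) + C₂ / Q := by
                refine add_le_add (h1.trans ?_) (hnear i)
                gcongr
            _ = (C₂ + 2) / Q := by ring
            _ ≤ _ := by
                gcongr
                push_cast
                nlinarith

/-! ### Normalized point clouds and the grid cells that they meet -/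

theorem frobenius_norm_sq {d n : ℕ} (A : Matrix (Fin d) (Fin n) ℝ) :
    ‖A‖ ^ 2 = ∑ i, ∑ j, A i j ^ 2 := by
  rw [Matrix.frobenius_norm_def, ← Real.sqrt_eq_rpow, Real.sq_sqrt (by positivity)]
  simp

/-- The centered point clouds whose matrices have pairwise orthogonal rows and Frobenius norm at
most `1`. The clouds `U⁻¹ * cent X` in the SVD frame are of this form. -/
def orthogonalClouds (d n : ℕ) : Set (Matrix (Fin d) (Fin n) ℝ) :=
  {Y | (∀ i j, i ≠ j → ∑ k, Y i k * Y j k = 0) ∧ (∀ i, ∑ k, Y i k = 0) ∧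
    ∑ i, ∑ k, Y i k ^ 2 ≤ 1}

theorem mem_Icc_of_mem_orthogonalClouds {d n : ℕ} {Y : Matrix (Fin d) (Fin n) ℝ}
    (hY : Y ∈ orthogonalClouds d n) (i : Fin d) (j : Fin n) : Y i j ∈ Set.Icc (-1) 1 := by
  rw [Set.mem_Icc, ← abs_le, ← sq_le_one_iff_abs_le_one]
  refine le_trans ?_ hY.2.2
  refine le_trans ?_ (Finset.single_le_sum (f := fun i => ∑ k, Y i k ^ 2)
    (fun _ _ => Finset.sum_nonneg fun _ _ => sq_nonneg _) (Finset.mem_univ i))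
  exact Finset.single_le_sum (f := fun k => Y i k ^ 2) (fun _ _ => sq_nonneg _) (Finset.mem_univ j)

theorem cent_apply {d n : ℕ} (X : Matrix (Fin d) (Fin n) ℝ) (i : Fin d) (k : Fin n) :
    cent X i k = X i k - (n : ℝ)⁻¹ * ∑ l, X i l := by
  change X i k - (n : ℝ)⁻¹ * ∑ l, X i l * (1 : ℝ) = _
  simp only [mul_one]

theorem sum_cent_apply {d n : ℕ} (hn : n ≠ 0) (X : Matrix (Fin d) (Fin n) ℝ) (i : Fin d) :
    ∑ k, cent X i k = 0 := by
  have hn' : (n : ℝ) ≠ 0 := by exact_mod_cast hn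
  simp only [cent_apply, Finset.sum_sub_distrib, Finset.sum_const, Finset.card_univ,
    Fintype.card_fin, nsmul_eq_mul]
  field_simp
  ring

theorem inv_mul_cent_mem_orthogonalClouds {d n : ℕ} (hdn : d + 1 ≤ n)
    {X : Matrix (Fin d) (Fin n) ℝ} (hX : ‖cent X‖ ≤ 1) {U : Matrix (Fin d) (Fin d) ℝ}
    (hU : U ∈ svdFactors (cent X)) : U⁻¹ * cent X ∈ orthogonalClouds d n := by
  obtain ⟨hO, V, hV, hA⟩ := hU
  have hUU : Uᵀ * U = 1 := (Matrix.mem_orthogonalGroup_iff' (Fin d) ℝ).1 hO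
  have hUU' : U * Uᵀ = 1 := (Matrix.mem_orthogonalGroup_iff (Fin d) ℝ).1 hO
  rw [Matrix.inv_eq_left_inv hUU]
  set A := cent X with hAdef
  set σ := matrixSingularValues A
  have hY : Uᵀ * A = Matrix.diagonal σ * Vᵀ := by
    conv_lhs => rw [hA]
    rw [← Matrix.mul_assoc, ← Matrix.mul_assoc, hUU, Matrix.one_mul]
  have hYY : (Uᵀ * A) * (Uᵀ * A)ᵀ = Matrix.diagonal σ * Matrix.diagonal σ := by
    rw [hY, Matrix.transpose_mul, Matrix.transpose_transpose, Matrix.diagonal_transpose]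
    calc _ = Matrix.diagonal σ * (Vᵀ * V) * Matrix.diagonal σ := by simp only [Matrix.mul_assoc]
      _ = _ := by rw [hV, Matrix.mul_one]
  refine ⟨fun i j hij => ?_, fun i => ?_, ?_⟩
  · have h := congrFun (congrFun hYY i) j
    rw [Matrix.diagonal_mul_diagonal, Matrix.diagonal_apply_ne _ hij, Matrix.mul_apply] at h
    simpa using h
  · simp only [Matrix.mul_apply]
    rw [Finset.sum_comm]
    refine Finset.sum_eq_zero fun k _ => ?_
    rw [← Finset.mul_sum, sum_cent_apply (by omega), mul_zero]
  · have h1 : ∀ B : Matrix (Fin d) (Fin n) ℝ, ∑ i, ∑ k, B i k ^ 2 = (Bᵀ * B).trace := by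
      intro B
      simp only [Matrix.trace, Matrix.diag_apply, Matrix.mul_apply, Matrix.transpose_apply]
      rw [Finset.sum_comm]
      simp only [sq]
    rw [h1, Matrix.transpose_mul, Matrix.transpose_transpose]
    have h2 : Aᵀ * U * (Uᵀ * A) = Aᵀ * A := by
      calc _ = Aᵀ * (U * Uᵀ) * A := by simp only [Matrix.mul_assoc]
        _ = _ := by rw [hUU', Matrix.mul_one]
    rw [h2, ← h1, ← frobenius_norm_sq]
    exact pow_le_one₀ (norm_nonneg _) hX

theorem floor_le_floor_add {a b : ℝ} {G : ℕ} (h : a ≤ b + G) : ⌊a⌋₊ ≤ ⌊b⌋₊ + G := by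
  rcases le_or_gt 0 b with hb | hb
  · rw [← Nat.floor_add_natCast hb]
    exact Nat.floor_le_floor h
  · refine (Nat.floor_le_of_le ?_).trans (Nat.le_add_left _ _)
    linarith

theorem floor_close {a b : ℝ} {G : ℕ} (h : |a - b| ≤ G) :
    ⌊a⌋₊ ∈ Finset.Icc (⌊b⌋₊ - G) (⌊b⌋₊ + G) := by
  rw [abs_le] at h
  have h1 := floor_le_floor_add (a := a) (b := b) (G := G) (by linarith)
  have h2 := floor_le_floor_add (a := b) (b := a) (G := G) (by linarith)
  rw [Finset.mem_Icc]
  omega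

/-- Normalized point clouds meet only `O (2 ^ (L * K))` cells of the grid, where
`K = ∑_{i < d} (n - 1 - i)` is the dimension of the set of these clouds. -/
theorem exists_card_cells_le {d n : ℕ} (hdn : d + 1 ≤ n) :
    ∃ C : ℕ, ∀ (L : ℕ) (τ : ℝ), ∃ T : Finset (Fin d → Fin n → ℕ),
      T.card ≤ C * (2 ^ L) ^ (∑ i ∈ Finset.range d, (n - 1 - i)) ∧
      ∀ Y ∈ orthogonalClouds d n, (fun i j => gridIndex L τ (Y i j)) ∈ T := by
  classical
  obtain ⟨C, hC⟩ := exists_orthogonal_net d (n - 1) (by omega)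
  refine ⟨C * (2 * C + 1) ^ (n * d), fun L τ => ?_⟩
  let one : EuclideanSpace ℝ (Fin n) := WithLp.toLp 2 fun _ => 1
  have hone : one ≠ 0 := by
    intro h
    have := congrArg (fun x : EuclideanSpace ℝ (Fin n) => x ⟨0, by omega⟩) h
    simp [one] at this
  have : Fact (Module.finrank ℝ (EuclideanSpace ℝ (Fin n)) = (n - 1) + 1) :=
    ⟨by rw [finrank_euclideanSpace_fin]; omega⟩
  obtain ⟨T, hT, hnet⟩ := hC (Submodule.span ℝ {one})ᗮ
    (Submodule.finrank_orthogonal_span_singleton hone) (2 ^ L) (by positivity)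
  refine ⟨T.biUnion fun c => Fintype.piFinset fun i => Fintype.piFinset fun j =>
    Finset.Icc (gridIndex L τ ((c i : EuclideanSpace ℝ (Fin n)) j) - C)
      (gridIndex L τ ((c i : EuclideanSpace ℝ (Fin n)) j) + C), ?_, fun Y hY => ?_⟩
  · refine (Finset.card_biUnion_le_card_mul _ _ ((2 * C + 1) ^ (n * d)) fun c _ => ?_).trans ?_
    · rw [Fintype.card_piFinset]
      refine (Finset.prod_le_pow_card _ _ ((2 * C + 1) ^ n) fun i _ => ?_).trans (by
        simp [← pow_mul])
      rw [Fintype.card_piFinset]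
      refine (Finset.prod_le_pow_card _ _ (2 * C + 1) fun j _ => ?_).trans (by simp)
      rw [Nat.card_Icc]
      omega
    · calc _ ≤ (C * (2 ^ L) ^ (∑ i ∈ Finset.range d, (n - 1 - i))) * (2 * C + 1) ^ (n * d) :=
            Nat.mul_le_mul_right _ hT
        _ = _ := by ring
  · let y : Fin d → (Submodule.span ℝ {one})ᗮ := fun i => ⟨WithLp.toLp 2 (Y i), by
      rw [Submodule.mem_orthogonal_singleton_iff_inner_right, PiLp.inner_apply]
      simpa [one] using hY.2.1 i⟩
    obtain ⟨c, hcT, hc⟩ := hnet y (fun i j hij => by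
      have := hY.1 j i hij.symm
      rw [Submodule.coe_inner, PiLp.inner_apply]
      simpa [y] using this) (fun i => by
      rw [← sq_le_one_iff₀ (norm_nonneg _), Submodule.coe_norm, EuclideanSpace.norm_sq_eq]
      refine le_trans ?_ hY.2.2
      simpa [y] using Finset.single_le_sum (f := fun i => ∑ k, Y i k ^ 2)
        (fun _ _ => Finset.sum_nonneg fun _ _ => sq_nonneg _) (Finset.mem_univ i))
    refine Finset.mem_biUnion.2 ⟨c, hcT, ?_⟩
    rw [Fintype.mem_piFinset]
    intro i
    rw [Fintype.mem_piFinset]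
    intro j
    refine floor_close ?_
    have h1 : |Y i j - (c i : EuclideanSpace ℝ (Fin n)) j| ≤ C / 2 ^ L := by
      have h2 := PiLp.norm_apply_le ((y i - c i : (Submodule.span ℝ {one})ᗮ) :
        EuclideanSpace ℝ (Fin n)) j
      have h3 := h2.trans (hc i)
      simpa [y] using h3
    rw [show 2 ^ L * ((Y i j + 2) / 8) + τ - (2 ^ L * (((c i : EuclideanSpace ℝ (Fin n)) j + 2) / 8)
      + τ) = 2 ^ L * (Y i j - (c i : EuclideanSpace ℝ (Fin n)) j) / 8 by ring, abs_div, abs_mul,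
      abs_of_pos (by positivity : (0 : ℝ) < 2 ^ L), abs_of_pos (by norm_num : (0 : ℝ) < 8)]
    rw [le_div_iff₀ (by positivity)] at h1
    have hC0 : (0 : ℝ) ≤ C := Nat.cast_nonneg _
    linarith

/-- Among the grids shifted by the fractions `s / m` of the mesh, at most one has `u` slightly
below the upper end of a cell. -/
theorem eq_of_fract_add_div_gt {m : ℕ} {u : ℝ} {s s' : Fin m}
    (h : 1 - 1 / (m : ℝ) < Int.fract (u + (s : ℕ) / m))
    (h' : 1 - 1 / (m : ℝ) < Int.fract (u + (s' : ℕ) / m)) : s = s' := by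
  have hm : (0 : ℝ) < m := by exact_mod_cast s.pos
  have e := Int.floor_add_fract (u + (s : ℕ) / m)
  have e' := Int.floor_add_fract (u + (s' : ℕ) / m)
  have hl := Int.fract_lt_one (u + (s : ℕ) / m)
  have hl' := Int.fract_lt_one (u + (s' : ℕ) / m)
  set k := ⌊u + (s : ℕ) / m⌋
  set k' := ⌊u + (s' : ℕ) / m⌋
  set r := Int.fract (u + (s : ℕ) / m)
  set r' := Int.fract (u + (s' : ℕ) / m)
  have h1 : ((s : ℕ) : ℝ) - (s' : ℕ) - m * (k - k') = m * (r - r') := by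
    have : ((s : ℕ) : ℝ) / m - (s' : ℕ) / m = (k - k') + (r - r') := by linarith
    field_simp at this
    linarith
  have hm1 : m * (1 / (m : ℝ)) = 1 := by field_simp
  have h2 : ((s : ℕ) : ℝ) - (s' : ℕ) - m * (k - k') < 1 := by rw [h1]; nlinarith
  have h3 : -1 < ((s : ℕ) : ℝ) - (s' : ℕ) - m * (k - k') := by rw [h1]; nlinarith
  -- the difference of the shifts is a multiple of `m`
  have h4 : ((s : ℕ) : ℤ) - (s' : ℕ) - m * (k - k') = 0 := by
    have h5 : ((s : ℕ) : ℤ) - (s' : ℕ) - m * (k - k') < 1 := by exact_mod_cast h2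
    have h6 : -1 < ((s : ℕ) : ℤ) - (s' : ℕ) - m * (k - k') := by exact_mod_cast h3
    omega
  have hs := s.isLt
  have hs' := s'.isLt
  have hk : k - k' = 0 := by
    by_contra hne
    rcases lt_or_gt_of_ne hne with hlt | hgt
    · have : (m : ℤ) * (k - k') ≤ m * (-1) := by gcongr; omega
      omega
    · have : (m : ℤ) * 1 ≤ m * (k - k') := by gcongr; omega
      omega
  rw [hk, mul_zero] at h4
  exact Fin.ext (by omega)

/-- More than half of `2 * (d * n) + 1` equidistant shifts of the grid are good for all entries of a
cloud. -/
theorem card_good_shifts {d n : ℕ} (L : ℕ) (Y : Matrix (Fin d) (Fin n) ℝ) :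
    d * n + 1 ≤ (Finset.univ.filter fun s : Fin (2 * (d * n) + 1) => ∀ i j,
      Int.fract (2 ^ L * ((Y i j + 2) / 8) + ((s : ℕ) : ℝ) / ((2 * (d * n) + 1 : ℕ) : ℝ)) ≤
        1 - 1 / ((2 * (d * n) + 1 : ℕ) : ℝ)).card := by
  classical
  set m := 2 * (d * n) + 1
  let good : Fin m → Prop := fun s => ∀ i j,
    Int.fract (2 ^ L * ((Y i j + 2) / 8) + ((s : ℕ) : ℝ) / (m : ℝ)) ≤ 1 - 1 / (m : ℝ)
  have hbad : (Finset.univ.filter fun s => ¬ good s).card ≤ d * n := by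
    have hsub : (Finset.univ.filter fun s => ¬ good s) ⊆
        (Finset.univ : Finset (Fin d × Fin n)).biUnion fun p => Finset.univ.filter fun s : Fin m =>
          1 - 1 / (m : ℝ) < Int.fract (2 ^ L * ((Y p.1 p.2 + 2) / 8) + ((s : ℕ) : ℝ) / (m : ℝ)) := by
      intro s hs
      simp only [Finset.mem_filter, Finset.mem_univ, true_and, good] at hs
      push Not at hs
      obtain ⟨i, j, h⟩ := hs
      exact Finset.mem_biUnion.2 ⟨(i, j), Finset.mem_univ _, Finset.mem_filter.2
        ⟨Finset.mem_univ _, h⟩⟩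
    refine (Finset.card_le_card hsub).trans
      ((Finset.card_biUnion_le_card_mul _ _ 1 fun p _ => ?_).trans (by simp))
    refine Finset.card_le_one.2 fun s hs s' hs' => ?_
    exact eq_of_fract_add_div_gt (Finset.mem_filter.1 hs).2 (Finset.mem_filter.1 hs').2
  have := Finset.card_filter_add_card_filter_not (s := (Finset.univ : Finset (Fin m))) good
  rw [Finset.card_univ, Fintype.card_fin] at this
  change d * n + 1 ≤ (Finset.univ.filter good).card
  omega

/-! ### Approximation by Deep Sets models -/

/-- The cell of the point `j` of the cloud `Y`, as an integer of `L * d` bits. -/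
noncomputable def pointCell {d n : ℕ} (L : ℕ) (τ : ℝ) (Y : Matrix (Fin d) (Fin n) ℝ) (j : Fin n) :
    ℕ :=
  packDigits L (fun i => gridIndex L τ (Y i j)) 0 (List.finRange d)

/-- The code of the multiset of the cells of the points of a cloud. -/
noncomputable def cloudCode {d n : ℕ} (L : ℕ) (τ : ℝ) (Y : Matrix (Fin d) (Fin n) ℝ) : ℕ :=
  tupleCode (L * d) (pointCell L τ Y)

theorem pointCell_lt {d n L : ℕ} (hL : 1 ≤ L) {τ : ℝ} (hτ1 : τ < 1) {Y : Matrix (Fin d) (Fin n) ℝ}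
    (hY : Y ∈ orthogonalClouds d n) (j : Fin n) : pointCell L τ Y j < 2 ^ (L * d) := by
  have := packDigits_lt (L := L) (q := fun i => gridIndex L τ (Y i j)) (List.finRange d)
    (fun i _ => gridIndex_lt hL hτ1 (mem_Icc_of_mem_orthogonalClouds hY i j).2) 0
  simpa [pointCell] using this

/-- Clouds with the same code agree up to the mesh, after reordering the points. -/
theorem exists_perm_of_cloudCode_eq {d n L : ℕ} (hL : 1 ≤ L) {τ : ℝ} (hτ0 : 0 ≤ τ) (hτ1 : τ < 1)
    {Y Y' : Matrix (Fin d) (Fin n) ℝ} (hY : Y ∈ orthogonalClouds d n)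
    (hY' : Y' ∈ orthogonalClouds d n) (h : cloudCode L τ Y = cloudCode L τ Y') :
    ∃ σ : Equiv.Perm (Fin n), ∀ i j, |Y i j - Y' i (σ j)| ≤ 8 / 2 ^ L := by
  obtain ⟨σ, hσ⟩ := exists_perm_of_tupleCode_eq (pointCell_lt hL hτ1 hY) (pointCell_lt hL hτ1 hY') h
  refine ⟨σ, fun i j => ?_⟩
  have h1 := (packDigits_inj (List.finRange d)
    (fun i _ => gridIndex_lt hL hτ1 (mem_Icc_of_mem_orthogonalClouds hY' i (σ j)).2)
    (fun i _ => gridIndex_lt hL hτ1 (mem_Icc_of_mem_orthogonalClouds hY i j).2) (hσ j)).2 i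
    (List.mem_finRange i)
  have hpos : ∀ y : ℝ, y ∈ Set.Icc (-1) 1 → 0 ≤ 2 ^ L * ((y + 2) / 8) + τ := fun y hy => by
    have : 0 ≤ (y + 2) / 8 := by linarith [hy.1]
    positivity
  have hpos₁ := hpos _ (mem_Icc_of_mem_orthogonalClouds hY' i (σ j))
  have hpos₂ := hpos _ (mem_Icc_of_mem_orthogonalClouds hY i j)
  have hfl : (⌊2 ^ L * ((Y' i (σ j) + 2) / 8) + τ⌋ : ℤ) = ⌊2 ^ L * ((Y i j + 2) / 8) + τ⌋ := by
    rw [← Int.natCast_floor_eq_floor hpos₁, ← Int.natCast_floor_eq_floor hpos₂]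
    exact congrArg Nat.cast h1
  have h2 := Int.abs_sub_lt_one_of_floor_eq_floor hfl
  rw [show 2 ^ L * ((Y' i (σ j) + 2) / 8) + τ - (2 ^ L * ((Y i j + 2) / 8) + τ) =
    2 ^ L * (Y' i (σ j) - Y i j) / 8 by ring, abs_div, abs_mul, abs_sub_comm,
    abs_of_pos (by positivity : (0 : ℝ) < 2 ^ L), abs_of_pos (by norm_num : (0 : ℝ) < 8)] at h2
  rw [le_div_iff₀ (by positivity)]
  rw [div_lt_one (by norm_num)] at h2
  linarith

/-- The total size of the two networks, `W` parameters for each layer, in terms of a bound `R` for the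
square root of the number of cells and of the numbers `L` and `e` of bits. -/
theorem size_estimate {n d C T L e w A R W : ℝ} (hn : 0 ≤ n) (hd : 0 ≤ d) (hC : 0 ≤ C)
    (hT : 0 ≤ T) (hL : 1 ≤ L) (he : 0 ≤ e) (hW : 0 ≤ W) (hR : 1 ≤ R) (hw0 : 0 ≤ w)
    (hA : A ≤ (C + 2) * R) (hw : w = n * (2 * n) + L * (d * (2 * n) * (2 * n))) :
    (2 * n * (L * d) + d * L + 1) * W + (T + (A * (w + e + 1) + A) + 1) * W ≤
      W * (2 * n * d + d + 1 + T + 1 + (C + 2) * (n * (2 * n) + d * (2 * n) * (2 * n) + 3)) * R *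
        (L + e + 1) := by
  set V := L + e + 1 with hV
  have hV1 : 1 ≤ V := by linarith
  have hRV : 1 ≤ R * V := one_le_mul_of_one_le_of_one_le hR hV1
  have hLRV : L ≤ R * V := by
    calc L ≤ 1 * V := by linarith
      _ ≤ R * V := by gcongr
  have hwV : w + e + 2 ≤ (n * (2 * n) + d * (2 * n) * (2 * n) + 3) * V := by
    have h1 : n * (2 * n) * 1 ≤ n * (2 * n) * V := by gcongr
    have h2 : d * (2 * n) * (2 * n) * L ≤ d * (2 * n) * (2 * n) * V := by gcongr; linarith
    rw [hw]
    linarith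
  have h1 : (2 * n * d + d) * L ≤ (2 * n * d + d) * (R * V) := by gcongr
  have h2 : (T + 2) * 1 ≤ (T + 2) * (R * V) := by gcongr
  have h3 : A * (w + e + 2) ≤
      ((C + 2) * R) * ((n * (2 * n) + d * (2 * n) * (2 * n) + 3) * V) := by gcongr
  have h4 : (2 * n * (L * d) + d * L + 1) + (T + (A * (w + e + 1) + A) + 1) ≤
      (2 * n * d + d + 1 + T + 1 + (C + 2) * (n * (2 * n) + d * (2 * n) * (2 * n) + 3)) *
        (R * V) := by
    linarith
  calc _ = W * ((2 * n * (L * d) + d * L + 1) + (T + (A * (w + e + 1) + A) + 1)) := by ring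
    _ ≤ W * ((2 * n * d + d + 1 + T + 1 + (C + 2) * (n * (2 * n) + d * (2 * n) * (2 * n) + 3)) *
        (R * V)) := by gcongr
    _ = _ := by ring

/-- A function that varies by at most `η` between clouds that agree up to the mesh `8 / 2 ^ L` and a
permutation is approximated, up to `η` and an error of `e` bits, by a Deep Sets model whose size is
essentially the square root of the number of cells that the clouds meet. -/
theorem exists_deepSets_approx {d n : ℕ} (hdn : d + 1 ≤ n) :
    ∃ C : ℝ, 0 ≤ C ∧ ∀ (L e : ℕ), 1 ≤ L → ∀ (f : Matrix (Fin d) (Fin n) ℝ → ℝ) (c η : ℝ), 0 ≤ η →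
      (∀ Y ∈ orthogonalClouds d n, |f Y - c| ≤ 1) →
      (∀ Y ∈ orthogonalClouds d n, ∀ Y' ∈ orthogonalClouds d n,
        (∃ σ : Equiv.Perm (Fin n), ∀ i j, |Y i j - Y' i (σ j)| ≤ 8 / 2 ^ L) →
          |f Y - f Y'| ≤ η) →
      ∃ ψ : DeepSets d,
        (ψ.numParams : ℝ) ≤
          C * √((2 ^ L) ^ (∑ i ∈ Finset.range d, (n - 1 - i))) * (L + e + 1) ∧
        ∀ Y ∈ orthogonalClouds d n, |f Y - ψ.eval Y| ≤ η + 4 / 2 ^ e := by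
  classical
  set K := ∑ i ∈ Finset.range d, (n - 1 - i)
  obtain ⟨C₀, hC₀⟩ := exists_card_cells_le hdn
  set m := 2 * (d * n) + 1 with hm
  have hm0 : 0 < m := by omega
  obtain ⟨Tm, hmed⟩ := exists_layered_median (Fin m) (d * n) (by simp [hm])
  set H := m * (2 * (d + 4) + 3) + m * 13 + (2 * (m + 2) + 1) with hH
  set W : ℝ := ((H * H + H : ℕ) : ℝ)
  refine ⟨W * (2 * n * d + d + 1 + Tm + 1 + (C₀ + 2) * (n * (2 * n) + d * (2 * n) * (2 * n) + 3)),
    by positivity, fun L e hL f c η hη hfc hf => ?_⟩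
  let τ : Fin m → ℝ := fun s => ((s : ℕ) : ℝ) / (m : ℝ)
  have hmR : (0 : ℝ) < m := by exact_mod_cast hm0
  have hτ0 : ∀ s, 0 ≤ τ s := fun s => by positivity
  have hτ1 : ∀ s, τ s < 1 := fun s => by
    simp only [τ]
    rw [div_lt_one hmR]
    exact_mod_cast s.isLt
  -- `S s` holds the codes that occur for the shift `s`; `rep s z` is a cloud with code `z`
  have hS : ∀ s, ∃ S : Finset ℕ, S.card ≤ C₀ * (2 ^ L) ^ K ∧
      (∀ z ∈ S, ∃ Y ∈ orthogonalClouds d n, cloudCode L (τ s) Y = z) ∧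
      ∀ Y ∈ orthogonalClouds d n, cloudCode L (τ s) Y ∈ S := by
    intro s
    obtain ⟨T, hT, hTY⟩ := hC₀ L (τ s)
    refine ⟨(T.image fun q => tupleCode (L * d) fun j =>
      packDigits L (fun i => q i j) 0 (List.finRange d)).filter
        fun z => ∃ Y ∈ orthogonalClouds d n, cloudCode L (τ s) Y = z, ?_, ?_, ?_⟩
    · exact (Finset.card_filter_le _ _).trans (Finset.card_image_le.trans hT)
    · exact fun z hz => (Finset.mem_filter.1 hz).2
    · exact fun Y hY => Finset.mem_filter.2 ⟨Finset.mem_image.2 ⟨_, hTY Y hY, rfl⟩, Y, hY, rfl⟩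
  choose S hScard hSrep hSmem using hS
  choose! rep hrepM hrep using hSrep
  -- the values of `f`, which lie in `[c - 1, c + 1]`, rounded to multiples of `4 / 2 ^ e`
  let l : Fin m → ℕ → ℕ := fun s z => ⌊(f (rep s z) - c + 1) * 2 ^ e / 4⌋₊
  have h2e : (0 : ℝ) < 2 ^ e := by positivity
  have hl : ∀ s, ∀ z ∈ S s, l s z < 2 ^ e := by
    intro s z hz
    have h1 := abs_le.1 (hfc _ (hrepM s z hz))
    refine (Nat.floor_lt' (by positivity)).2 ?_
    push_cast
    nlinarith
  set w := powerBits n (L * d) * (2 * n) with hw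
  have hSw : ∀ s, ∀ z ∈ S s, z < 2 ^ w := by
    intro s z hz
    rw [← hrep s z hz]
    exact tupleCode_lt (pointCell_lt hL (hτ1 s) (hrepM s z hz))
  set A := Nat.sqrt (C₀ * (2 ^ L) ^ K) + 1 with hAdef
  have hA : ∀ s, (S s).card ≤ A * A := fun s =>
    (hScard s).trans (Nat.lt_succ_sqrt _).le
  choose look hlook hlookS using fun s => exists_layered_lookup (S s) (l s) (hSw s) (hl s) (hA s)
  choose enc henc hencY using fun s : Fin m =>
    exists_layered_encoder d n L hm0 hL (hτ0 s) (hτ1 s)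
  -- the labels are at most `2 ^ e / 2`; the upper bound leaves room for the error `η`
  obtain ⟨med, hmedL, hmedI⟩ := hmed ((2 + η) * 2 ^ e / 4)
  -- the inner network
  have hinner : Layered H (2 * n * (L * d) + d * L)
      fun (x : Fin d → ℝ) (s : Fin m) => enc s x () := by
    have h1 := (Layered.pi (S := Fin m) henc).precomp
      (A := fun (x : Fin d → ℝ) (p : Σ _ : Fin m, Fin d) => x p.2) fun p => isAffineFun_apply _
    have h2 := h1.postcomp (μ := Fin m) (A := fun y s => y ⟨s, ()⟩) fun s => isAffineFun_apply _
    refine h2.mono ?_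
    rw [Fintype.card_fin, hH]
    omega
  -- the outer network
  have houter : Layered H (Tm + (A * (w + e + 1) + A)) fun (z : Fin m → ℝ) (_ : Fin 1) =>
      c - 1 + 4 / 2 ^ e * med (fun s => look s (fun _ => z s) ()) () := by
    have h1 := (Layered.pi (S := Fin m) hlook).precomp
      (A := fun (z : Fin m → ℝ) (p : Σ _ : Fin m, Unit) => z p.1) fun p => isAffineFun_apply _
    have h2 := h1.postcomp (μ := Fin m) (A := fun y s => y ⟨s, ()⟩) fun s => isAffineFun_apply _
    have h3 : Layered H (A * (w + e + 1) + A)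
        fun (z : Fin m → ℝ) (s : Fin m) => look s (fun _ => z s) () := by
      refine h2.mono ?_
      rw [Fintype.card_fin, hH]
      omega
    have h4 : Layered H Tm med := hmedL.mono (by rw [Fintype.card_fin, hH]; omega)
    exact (h4.comp h3).postcomp (μ := Fin 1) (A := fun y _ => c - 1 + 4 / 2 ^ e * y ())
      fun _ => isAffineFun_iff.2 fun a x y => by simp; ring
  obtain ⟨N₁, hN₁, hP₁⟩ := hinner.exists_network (by rw [hH]; nlinarith) (by rw [hH]; omega)
  obtain ⟨N₂, hN₂, hP₂⟩ := houter.exists_network (by rw [hH]; omega) (by rw [hH]; omega)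
  refine ⟨⟨m, N₁, N₂⟩, ?_, fun Y hY => ?_⟩
  · set R := √((2 ^ L : ℝ) ^ K) with hR
    have hR1 : 1 ≤ R := by
      rw [hR, Real.one_le_sqrt]
      exact one_le_pow₀ (one_le_pow₀ one_le_two)
    have hAR : (A : ℝ) ≤ (C₀ + 2) * R := by
      have h1 : (Nat.sqrt (C₀ * (2 ^ L) ^ K) : ℝ) ≤ √(C₀ * (2 ^ L) ^ K) := by
        have := Real.nat_sqrt_le_real_sqrt (a := C₀ * (2 ^ L) ^ K)
        push_cast at this
        exact this
      have h2 : √(C₀ * (2 ^ L : ℝ) ^ K) ≤ (C₀ + 1) * R := by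
        rw [Real.sqrt_mul (Nat.cast_nonneg _)]
        gcongr
        rw [Real.sqrt_le_left (by positivity)]
        have : (0 : ℝ) ≤ C₀ := Nat.cast_nonneg _
        nlinarith
      rw [hAdef]
      push_cast
      nlinarith
    calc ((DeepSets.numParams ⟨m, N₁, N₂⟩ : ℕ) : ℝ) = N₁.numParams + N₂.numParams := by
          rw [DeepSets.numParams]; push_cast; rfl
      _ ≤ ((2 * n * (L * d) + d * L + 1 : ℕ) : ℝ) * W +
          ((Tm + (A * (w + e + 1) + A) + 1 : ℕ) : ℝ) * W := by
          simp only [W]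
          exact_mod_cast add_le_add hP₁ hP₂
      _ ≤ _ := by
          push_cast
          exact size_estimate (by positivity) (by positivity) (by positivity) (by positivity)
            (by exact_mod_cast hL) (by positivity) (by positivity) hR1 (by positivity)
            hAR (by rw [hw, powerBits]; push_cast; ring)
  · -- for most shifts, all entries of `Y` are in the part of their cell where the network is exact
    have hgood := card_good_shifts L Y
    rw [← hm] at hgood
    set x : ℝ := (f Y - c + 1) * 2 ^ e / 4 with hx
    have hfY := abs_le.1 (hfc Y hY)
    have hηe : 0 ≤ η * 2 ^ e / 4 := by positivity
    have hx0 : 0 ≤ x := by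
      have : 0 ≤ f Y - c + 1 := by linarith
      positivity
    have hmem := hmedI (fun s => look s (fun _ => ∑ j, enc s (fun i => Y i j) ()) ())
      (max 0 (x - η * 2 ^ e / 4 - 1)) (x + η * 2 ^ e / 4) _ (le_max_left _ _)
      (max_le (by linarith) (by linarith)) (by
        rw [hx]
        have : (f Y - c + 1) * 2 ^ e ≤ 2 * 2 ^ e := by gcongr; linarith
        linarith) hgood (by
        intro s hs
        replace hs := (Finset.mem_filter.1 hs).2
        have hcode : ∑ j, enc s (fun i => Y i j) () = (cloudCode L (τ s) Y : ℝ) := by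
          rw [cloudCode, tupleCode, Nat.cast_sum]
          refine Finset.sum_congr rfl fun j _ => ?_
          exact hencY s (fun i => Y i j) (fun i => mem_Icc_of_mem_orthogonalClouds hY i j)
            fun i => hs i j
        have hz := hSmem s Y hY
        set z := cloudCode L (τ s) Y with hzdef
        rw [hcode, hlookS s z hz]
        have hclose := abs_le.1 (hf Y hY _ (hrepM s z hz)
          (exists_perm_of_cloudCode_eq hL (hτ0 s) (hτ1 s) hY (hrepM s z hz)
            (hzdef.symm.trans (hrep s z hz).symm)))
        have hfr := abs_le.1 (hfc _ (hrepM s z hz))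
        have h0 : 0 ≤ (f (rep s z) - c + 1) * 2 ^ e / 4 := by
          have : 0 ≤ f (rep s z) - c + 1 := by linarith
          positivity
        have h1 := Nat.floor_le h0
        have h2 := Nat.lt_floor_add_one ((f (rep s z) - c + 1) * 2 ^ e / 4)
        have h3 : (f (rep s z) - c + 1) * 2 ^ e / 4 ≤ x + η * 2 ^ e / 4 := by
          have : (f (rep s z) - c + 1) * 2 ^ e ≤ (f Y - c + 1 + η) * 2 ^ e :=
            mul_le_mul_of_nonneg_right (by linarith) h2e.le
          rw [hx]; linarith
        have h4 : x - η * 2 ^ e / 4 ≤ (f (rep s z) - c + 1) * 2 ^ e / 4 := by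
          have : (f Y - c + 1) * 2 ^ e ≤ (f (rep s z) - c + 1 + η) * 2 ^ e :=
            mul_le_mul_of_nonneg_right (by linarith) h2e.le
          rw [hx]; linarith
        refine ⟨max_le (Nat.cast_nonneg _) ?_, h1.trans h3⟩
        simp only [l]
        linarith)
    have heval : DeepSets.eval ⟨m, N₁, N₂⟩ Y = c - 1 + 4 / 2 ^ e *
        med (fun s => look s (fun _ => ∑ j, enc s (fun i => Y i j) ()) ()) () := by
      rw [DeepSets.eval, hN₁, hN₂]
      simp only [Finset.sum_apply]
    rw [heval]
    obtain ⟨hlow, hupp⟩ := hmem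
    have hlow' := (le_max_right _ _).trans hlow
    set M := med (fun s => look s (fun _ => ∑ j, enc s (fun i => Y i j) ()) ()) ()
    have hq : (0 : ℝ) < 4 / 2 ^ e := by positivity
    have e1 : 4 / 2 ^ e * x = f Y - c + 1 := by rw [hx]; field_simp
    have e2 : 4 / 2 ^ e * (η * 2 ^ e / 4) = η := by field_simp
    have h1 := mul_le_mul_of_nonneg_left hlow' hq.le
    have h2 := mul_le_mul_of_nonneg_left hupp hq.le
    rw [mul_sub, mul_sub, e1, e2] at h1
    rw [mul_add, e1, e2] at h2
    rw [abs_le]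
    constructor <;> linarith

/-! ### Averaging over the SVD frame -/

theorem IsRigidPermInvariant.apply_inv_mul_cent {d n : ℕ} {f : Matrix (Fin d) (Fin n) ℝ → ℝ}
    (hf : IsRigidPermInvariant f) {U : Matrix (Fin d) (Fin d) ℝ}
    (hU : U ∈ Matrix.orthogonalGroup (Fin d) ℝ) (X : Matrix (Fin d) (Fin n) ℝ) :
    f (U⁻¹ * cent X) = f X := by
  have hUU : Uᵀ * U = 1 := (Matrix.mem_orthogonalGroup_iff' (Fin d) ℝ).1 hU
  have hUU' : U * Uᵀ = 1 := (Matrix.mem_orthogonalGroup_iff (Fin d) ℝ).1 hU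
  have h1 : f (cent X) = f X := by
    rw [← hf 1 (one_mem _) (fun i => -((n : ℝ)⁻¹ * ∑ l, X i l)) 1 X]
    congr 1
    ext i j
    rw [cent_apply, Matrix.one_mul, Matrix.of_apply, Equiv.Perm.one_apply, sub_eq_add_neg]
  have hU' : Uᵀ ∈ Matrix.orthogonalGroup (Fin d) ℝ := by
    rw [Matrix.mem_orthogonalGroup_iff, Matrix.transpose_transpose]
    exact hUU
  rw [Matrix.inv_eq_left_inv hUU, ← h1, ← hf Uᵀ hU' 0 1 (cent X)]
  congr 1
  ext i j
  simp

theorem IsRigidPermInvariant.apply_submatrix {d n : ℕ} {f : Matrix (Fin d) (Fin n) ℝ → ℝ}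
    (hf : IsRigidPermInvariant f) (σ : Equiv.Perm (Fin n)) (X : Matrix (Fin d) (Fin n) ℝ) :
    f (X.submatrix id σ) = f X := by
  rw [← hf 1 (one_mem _) 0 σ X]
  congr 1
  ext i j
  simp

/-- Averaging over the SVD frame preserves approximations on the normalized clouds. -/
theorem abs_sub_svdFrameAverage_le {d n : ℕ} (hdn : d + 1 ≤ n)
    {f g : Matrix (Fin d) (Fin n) ℝ → ℝ} (hf : IsRigidPermInvariant f) {ε : ℝ}
    (hfg : ∀ Y ∈ orthogonalClouds d n, |f Y - g Y| ≤ ε) {X : Matrix (Fin d) (Fin n) ℝ}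
    (hX : X ∈ distinctSingularValueClouds d n) : |f X - svdFrameAverage g X| ≤ ε := by
  have hcard := ncard_svdFactors (by omega) (cent X) hX.1
  have hfin : (svdFactors (cent X)).Finite :=
    Set.finite_of_ncard_ne_zero (by rw [hcard]; positivity)
  rw [Set.ncard_eq_toFinset_card _ hfin] at hcard
  have h2 : (0 : ℝ) < 2 ^ d := by positivity
  have hfX : f X = ((2 : ℝ) ^ d)⁻¹ * ∑ _U ∈ hfin.toFinset, f X := by
    rw [Finset.sum_const, hcard, nsmul_eq_mul]
    push_cast
    field_simp
  rw [svdFrameAverage, finsum_mem_eq_finite_toFinset_sum _ hfin, hfX, ← mul_sub,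
    ← Finset.sum_sub_distrib, abs_mul, abs_of_pos (inv_pos.2 h2), inv_mul_le_iff₀ h2]
  refine (Finset.abs_sum_le_sum_abs _ _).trans
    ((Finset.sum_le_card_nsmul _ _ ε fun U hU => ?_).trans (by rw [hcard, nsmul_eq_mul]; simp))
  have hU' := hfin.mem_toFinset.1 hU
  rw [← hf.apply_inv_mul_cent hU'.1 X]
  exact hfg _ (inv_mul_cent_mem_orthogonalClouds hdn hX.2 hU')

/-- The dimension of the set of normalized clouds is the dimension of the space of clouds minus the
dimension of `E(d)`. -/
theorem sum_range_sub_eq {d n : ℕ} (hdn : d + 1 ≤ n) :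
    ((∑ i ∈ Finset.range d, (n - 1 - i) : ℕ) : ℝ) = (n : ℝ) * d - dimEuclideanGroup d := by
  have h1 : ∀ k, k ≤ d → 2 * (∑ i ∈ Finset.range k, (n - 1 - i)) + k * (k + 1) = 2 * (n * k) := by
    intro k
    induction k with
    | zero => simp
    | succ k ih =>
      intro hk
      have := ih (by omega)
      rw [Finset.sum_range_succ]
      obtain ⟨r, rfl⟩ : ∃ r, n = r + k + 1 := ⟨n - 1 - k, by omega⟩
      have e : r + k + 1 - 1 - k = r := by omega
      rw [e]
      nlinarith
  have h2 := h1 d le_rfl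
  have h3 : 2 * dimEuclideanGroup d = d * (d + 1) := by
    rw [dimEuclideanGroup_eq]
    exact Nat.mul_div_cancel' (Nat.even_mul_succ_self d).two_dvd
  have h4 : 2 * (∑ i ∈ Finset.range d, (n - 1 - i)) + 2 * dimEuclideanGroup d = 2 * (n * d) := by
    omega
  have h5 := congrArg (Nat.cast : ℕ → ℝ) h4
  push_cast at h5 ⊢
  linarith

theorem norm_le_of_forall_abs_le {d n : ℕ} {A : Matrix (Fin d) (Fin n) ℝ} {δ : ℝ} (hδ : 0 ≤ δ)
    (h : ∀ i j, |A i j| ≤ δ) : ‖A‖ ≤ (d * n + 1) * δ := by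
  refine le_of_sq_le_sq ?_ (by positivity)
  rw [frobenius_norm_sq]
  calc ∑ i, ∑ j, A i j ^ 2 ≤ ∑ _i : Fin d, ∑ _j : Fin n, δ ^ 2 := by
        refine Finset.sum_le_sum fun i _ => Finset.sum_le_sum fun j _ => ?_
        rw [← sq_abs]
        exact pow_le_pow_left₀ (abs_nonneg _) (h i j) 2
    _ = d * n * δ ^ 2 := by simp; ring
    _ ≤ (d * n + 1) ^ 2 * δ ^ 2 := by
        gcongr
        have : (0 : ℝ) ≤ d * n := by positivity
        nlinarith
    _ = _ := by ring

/-- The choice of the mesh, proportional to `2 ^ (-L)`, and of the number `e` of bits of the labels for a given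
accuracy. -/
theorem exists_resolution (K : ℕ) {b : ℝ} (hb : 1 ≤ b) {α : ℝ} (hα : 0 < α) :
    ∃ C : ℝ, 0 ≤ C ∧ ∀ ε : ℝ, 0 < ε → ε ≤ 1 → ∃ L e : ℕ, 1 ≤ L ∧ (b / 2 ^ L) ^ α ≤ ε / 2 ∧
      4 / 2 ^ e ≤ ε / 2 ∧
      √((2 ^ L) ^ K) * (L + e + 1) ≤ C * ε ^ (-(K / (2 * α))) * (1 + |Real.log ε|) := by
  -- `2 ^ L ≤ D * ε ^ (-1 / α)` and `2 ^ e ≤ 16 / ε`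
  set D : ℝ := 2 * (b * 2 ^ (1 / α)) with hD
  have h2α : (1 : ℝ) ≤ 2 ^ (1 / α) := Real.one_le_rpow one_le_two (by positivity)
  have hD2 : 2 ≤ D := by nlinarith
  have hlog2 : 0 < Real.log 2 := Real.log_pos one_lt_two
  have hlogD : 0 ≤ Real.log D := Real.log_nonneg (by linarith)
  have hlog16 : 0 ≤ Real.log 16 := Real.log_nonneg (by norm_num)
  set c : ℝ := (Real.log D + 1 / α + Real.log 16 + 1) / Real.log 2 + 1 with hc
  refine ⟨√(D ^ K) * c, by positivity, fun ε hε hε1 => ?_⟩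
  have hεinv : 1 ≤ ε⁻¹ := (one_le_inv₀ hε).2 hε1
  have hεα : 1 ≤ ε⁻¹ ^ (1 / α) := Real.one_le_rpow hεinv (by positivity)
  have hR : 1 ≤ b * 2 ^ (1 / α) * ε⁻¹ ^ (1 / α) := by
    have := one_le_mul_of_one_le_of_one_le hb h2α
    exact one_le_mul_of_one_le_of_one_le this hεα
  obtain ⟨k, hk1, hk2⟩ := exists_nat_pow_near hR one_lt_two
  obtain ⟨r, hr1, hr2⟩ := exists_nat_pow_near (show 1 ≤ 8 * ε⁻¹ by linarith) one_lt_two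
  have hlogε : |Real.log ε| = Real.log ε⁻¹ := by
    rw [Real.log_inv, abs_of_nonpos (Real.log_nonpos hε.le hε1)]
  have hlε0 : 0 ≤ |Real.log ε| := abs_nonneg _
  have hLle : (2 : ℝ) ^ (k + 1) ≤ D * ε⁻¹ ^ (1 / α) := by
    rw [pow_succ, hD]
    linarith
  have hele : (2 : ℝ) ^ (r + 1) ≤ 16 * ε⁻¹ := by
    rw [pow_succ]
    linarith
  refine ⟨k + 1, r + 1, by omega, ?_, ?_, ?_⟩
  · have h1 : b / 2 ^ (k + 1) ≤ (ε / 2) ^ (1 / α) := by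
      rw [div_le_iff₀ (by positivity)]
      have h2 : (ε / 2) ^ (1 / α) * (2 ^ (1 / α) * ε⁻¹ ^ (1 / α)) = 1 := by
        rw [← Real.mul_rpow (by positivity) (by positivity),
          ← Real.mul_rpow (by positivity) (by positivity)]
        have : ε / 2 * (2 * ε⁻¹) = 1 := by field_simp
        rw [this, Real.one_rpow]
      calc b = (ε / 2) ^ (1 / α) * (b * 2 ^ (1 / α) * ε⁻¹ ^ (1 / α)) := by
            linear_combination (-b) * h2
        _ ≤ _ := by gcongr
    calc (b / 2 ^ (k + 1)) ^ α ≤ ((ε / 2) ^ (1 / α)) ^ α := by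
          gcongr
      _ = ε / 2 := by
          rw [← Real.rpow_mul (by positivity), one_div_mul_cancel hα.ne', Real.rpow_one]
  · rw [div_le_iff₀ (by positivity)]
    have h3 : ε / 2 * (8 * ε⁻¹) = 4 := by field_simp; norm_num
    calc (4 : ℝ) = ε / 2 * (8 * ε⁻¹) := h3.symm
      _ ≤ _ := by gcongr
  · have hsqrt : √(((2 : ℝ) ^ (k + 1)) ^ K) ≤ √(D ^ K) * ε ^ (-(K / (2 * α))) := by
      have h1 : ((2 : ℝ) ^ (k + 1)) ^ K ≤ D ^ K * (ε ^ (-(K / (2 * α)))) ^ 2 := by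
        calc ((2 : ℝ) ^ (k + 1)) ^ K ≤ (D * ε⁻¹ ^ (1 / α)) ^ K := by gcongr
          _ = D ^ K * (ε ^ (-(K / (2 * α)))) ^ 2 := by
              rw [mul_pow, Real.inv_rpow hε.le, ← Real.rpow_neg hε.le, ← Real.rpow_natCast,
                ← Real.rpow_natCast _ K, ← Real.rpow_natCast _ 2, ← Real.rpow_mul hε.le,
                ← Real.rpow_mul hε.le]
              congr 2
              push_cast
              field_simp
      calc _ ≤ √(D ^ K * (ε ^ (-(K / (2 * α)))) ^ 2) := Real.sqrt_le_sqrt h1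
        _ = _ := by
            rw [Real.sqrt_mul (by positivity), Real.sqrt_sq (by positivity)]
    have hL' : ((k + 1 : ℕ) : ℝ) * Real.log 2 ≤ Real.log D + 1 / α * |Real.log ε| := by
      have h := Real.log_le_log (by positivity) hLle
      rw [Real.log_pow, Real.log_mul (by positivity) (by positivity),
        Real.log_rpow (by positivity)] at h
      rw [hlogε]
      exact h
    have he' : ((r + 1 : ℕ) : ℝ) * Real.log 2 ≤ Real.log 16 + |Real.log ε| := by
      have h := Real.log_le_log (by positivity) hele
      rw [Real.log_pow, Real.log_mul (by norm_num) (by positivity)] at h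
      rw [hlogε]
      exact h
    have hLe : (((k + 1 : ℕ) : ℝ) + ((r + 1 : ℕ) : ℝ) + 1) ≤ c * (1 + |Real.log ε|) := by
      have h1 : ((k + 1 : ℕ) : ℝ) + ((r + 1 : ℕ) : ℝ) ≤
          (Real.log D + 1 / α + Real.log 16 + 1) / Real.log 2 * (1 + |Real.log ε|) := by
        rw [div_mul_eq_mul_div, le_div_iff₀ hlog2]
        have h2 : 0 ≤ 1 / α := by positivity
        nlinarith [mul_nonneg hlogD hlε0, mul_nonneg hlog16 hlε0]
      rw [hc]
      linarith
    calc _ ≤ (√(D ^ K) * ε ^ (-(K / (2 * α)))) * (c * (1 + |Real.log ε|)) := by gcongr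
      _ = _ := by ring

theorem mainTheorem7 (d n : ℕ) (hdn : d + 1 ≤ n) (α : ℝ≥0) (hα₀ : 0 < α) (hα₁ : α ≤ 1) :
    ∃ C : ℝ, ∀ ε : ℝ, 0 < ε → ε ≤ 1 →
      ∀ f : Matrix (Fin d) (Fin n) ℝ → ℝ, IsRigidPermInvariant f → eHolderNorm α f = 1 →
        ∃ ψ : DeepSets d,
          (ψ.numParams : ℝ) ≤
            C * ε ^ (-(((n : ℝ) * d - dimEuclideanGroup d) / (2 * (α : ℝ)))) *
              (1 + |Real.log ε|) ∧
          ∀ X ∈ distinctSingularValueClouds d n,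
            |f X - svdFrameAverage ψ.eval X| ≤ ε := by
  have hα : (0 : ℝ) < α := hα₀
  obtain ⟨C₁, hC₁, happrox⟩ := exists_deepSets_approx hdn
  have hb : (1 : ℝ) ≤ (d * n + 1) * 8 := by
    have : (0 : ℝ) ≤ d * n := by positivity
    linarith
  obtain ⟨C₂, hC₂, hres⟩ := exists_resolution (∑ i ∈ Finset.range d, (n - 1 - i)) hb hα
  refine ⟨C₁ * C₂, fun ε hε hε1 f hf hnorm => ?_⟩
  obtain ⟨L, e, hL, hLε, heε, hsize⟩ := hres ε hε hε1
  have hmem : MemHolder α f := by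
    rw [← eHolderNorm_ne_top, hnorm]
    exact ENNReal.one_ne_top
  have hholder : ∀ Y Y', |f Y - f Y'| ≤ ‖Y - Y'‖ ^ (α : ℝ) := by
    intro Y Y'
    have h1 : nnHolderNorm α f = 1 := by
      have := hmem.coe_nnHolderNorm_eq_eHolderNorm
      rw [hnorm] at this
      exact_mod_cast this
    have h2 := hmem.holderWith.dist_le Y Y'
    rw [h1, NNReal.coe_one, one_mul, Real.dist_eq, dist_eq_norm] at h2
    exact h2
  obtain ⟨ψ, hψ, hψf⟩ := happrox L e hL f (f 0) (ε / 2) (by positivity)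
    (fun Y hY => by
      refine (hholder Y 0).trans (Real.rpow_le_one (norm_nonneg _) ?_ hα.le)
      rw [sub_zero, ← sq_le_one_iff₀ (norm_nonneg _), frobenius_norm_sq]
      exact hY.2.2)
    (fun Y _ Y' _ ⟨σ, hσ⟩ => by
      rw [← hf.apply_submatrix σ Y']
      refine (hholder _ _).trans (le_trans ?_ hLε)
      refine Real.rpow_le_rpow (norm_nonneg _) ?_ hα.le
      rw [mul_div_assoc]
      exact norm_le_of_forall_abs_le (by positivity) hσ)
  refine ⟨ψ, ?_, fun X hX => abs_sub_svdFrameAverage_le hdn hf (fun Y hY => ?_) hX⟩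
  · rw [← sum_range_sub_eq hdn]
    calc (ψ.numParams : ℝ) ≤ _ := hψ
      _ = C₁ * (√((2 ^ L) ^ (∑ i ∈ Finset.range d, (n - 1 - i))) * (L + e + 1)) := by ring
      _ ≤ C₁ * _ := mul_le_mul_of_nonneg_left hsize hC₁
      _ = _ := by ring
  · refine (hψf Y hY).trans ?_
    linarith
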